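/- **Scheme.** Let $\Delta x,\Delta t>0$ and $\lambda=\Delta x/\Delta t$. The D2Q13 scheme has the velocities $v_j=\lambda e_j$ with $e_j\in\{(0,0),(\pm1,0),(0,\pm1),(\pm1,\pm1),(\pm2,0),(0,\pm2)\}$ and the moments $m_k=\sum_j p_k(v_j)f_j$, $0\le k\le 12$, named $\rho,\,J_x,\,J_y,\,\varepsilon,\,XX,\,XY,\,q_x,\,q_y,\,r_x,\,r_y,\,\varepsilon_2,\,\varepsilon_3,\,XX_e$, where, with $v=(x,y)$ and $n=x^2+y^2$, $p_0,\dots,p_{12}$ are $1$; $x$; $y$; $13n-28\lambda^2$; $x^2-y^2$; $xy$; $x(n-3\lambda^2)$; $y(n-3\lambda^2)$; $x(\frac{35}{12}n^2-\frac{63}{4}\lambda^2n+\frac{101}{6}\lambda^4)$; $y(\frac{35}{12}n^2-\frac{63}{4}\lambda^2n+\frac{101}{6}\lambda^4)$; $\frac{77}{2}n^2-\frac{361}{2}\lambda^2n+140\lambda^4$; $\frac{137}{24}n^3-\frac{273}{8}\lambda^2n^2+\frac{581}{12}\lambda^4n-12\lambda^6$; $(x^2-y^2)(\frac{17}{12}n-\frac{65}{12}\lambda^2)$.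 One time step is $m_k^*=m_k$ for $k\le2$ and $m_k^*=m_k+s_k(m_k^{eq}-m_k)$ for $3\le k\le12$, followed by $f_j(x,t+\Delta t)=f_j^*(x-v_j\Delta t,t)$. The $m_k^{eq}$ are linear functions of $W=(\rho,J_x,J_y)$, $s_k\ne0$, and $\sigma_k=\frac1{s_k}-\frac12$. **Equivalent equations.** The moment matrix is invertible, and there is exactly one pair of formal series $\partial_tW=\sum_{\ell\ge0}\Delta t^\ell\alpha_{\ell+1}W$, $(m_3,\dots,m_{12})=\sum_{n\ge0}\Delta t^n\beta_nW$, with coefficients that are matrices of constant-coefficient space differential operators, which satisfies the Taylor-expanded scheme identically in $\Delta t$. The equivalent equation at order $\ell$ is $\partial_tW-\sum_{j=1}^{\ell}\Delta t^{j-1}\alpha_jW=0$. It is called rotation invariant if it is invariant under plane rotations, $\rho$ being transformed as a scalar and $J$ as a vector. Assume $\varepsilon^{eq}=\alpha\lambda^2\rho$, $XX^{eq}=XY^{eq}=0$, and put $c_s^2=\frac{28+\alpha}{26}$, $c_0^2=c_s^2\lambda^2$. Equilibria and relaxation parameters that are not mentioned in an item are arbitrary there. 1. *Order 1.* The equivalent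 equation is rotation invariant and equal to $\partial_t\rho+\mathrm{div}J=0$, $\partial_tJ+c_0^2\nabla\rho=0$. 2. *Order 2.* If $\sigma_4+\sigma_5\ne0$, $q^{eq}=\varphi\lambda^2J$ and $r^{eq}=\frac1{12}\,\frac{20\sigma_5-85\sigma_4-49\varphi\sigma_4-14\varphi\sigma_5}{\sigma_4+\sigma_5}\lambda^4J$, it is rotation invariant and equal to $\partial_t\rho+\mathrm{div}J=0$, $\partial_tJ+c_0^2\nabla\rho-\mu\Delta J-\zeta\nabla\mathrm{div}J=0$ with $\mu=\frac{\lambda\Delta x}{2}\frac{\sigma_4\sigma_5}{\sigma_4+\sigma_5}(3+\varphi)$, $\zeta=\frac{\lambda\Delta x}{26}\sigma_3(11+13\varphi-\alpha)$. 3. *Order 3.* Let $\sigma_4=\sigma_5$, $q^{eq}=\varphi\lambda^2J$, $r^{eq}=-\frac1{24}(65+63\varphi)\lambda^4J$. Then the mass equation is $\partial_t\rho+\mathrm{div}J+\xi\Delta\,\mathrm{div}J=0$ with $\xi=\frac1{624}(2\alpha-39\varphi-61)\Delta x^2$. If moreover $$\varepsilon_2^{eq}=\Big(-5\alpha+\tfrac{77}{26}\varphi\alpha+\tfrac{1078}{13}\varphi\Big)\lambda^4\rho,\quad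 \varepsilon_3^{eq}=\Big(\tfrac{\alpha}{48}-\tfrac{137}{12}-\tfrac{135}{208}\alpha\varphi-\tfrac{945}{52}\varphi\Big)\lambda^6\rho,\quad XX_e^{eq}=0,$$ the whole equation is rotation invariant and equal to this mass equation together with $\partial_tJ+c_0^2\nabla\rho-\mu\Delta J-\zeta\nabla\mathrm{div}J+\chi\nabla\Delta\rho=0$, where $\mu=\frac14\sigma_5(3+\varphi)\lambda\Delta x$, $\zeta=\frac1{26}\sigma_3(11+13\varphi-\alpha)\lambda\Delta x$, $$\chi=\tfrac{28+\alpha}{8112}\big(61+39\varphi+12\alpha\sigma_3^2-2\alpha-78\varphi\sigma_4^2-156\varphi\sigma_3^2-234\sigma_4^2-132\sigma_3^2\big)\lambda^2\Delta x^2.$$ 4. *Order 4.* Take the conditions of item 3 with $\varphi=-\frac75$; they then read $q^{eq}=-\frac75\lambda^2J$, $r^{eq}=\frac{29}{30}\lambda^4J$, $\varepsilon_2^{eq}=-(\frac{1189}{130}\alpha+\frac{7546}{65})\lambda^4\rho$, $\varepsilon_3^{eq}=(\frac{547}{39}+\frac{145}{156}\alpha)\lambda^6\rho$, $XX_e^{eq}=0$.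 Let $a$ be a real parameter, let $\sigma_3,\sigma_4\neq0$, $a\ne308$, $89a\ne20680$, $1189c_s^2\ne828$, and let $$\sigma_6=\sigma_7=\frac1{12\sigma_3},\qquad \sigma_8=\sigma_9=\frac5{24}\,\frac{155-a}{a-308}\,\frac1{\sigma_4}+\frac1{24}\,\frac{7a-1391}{a-308}\,\frac1{\sigma_3},$$ $$\sigma_{10}=\frac{3973}{45}\,\frac{43a-16610}{89a-20680}\,\frac{5c_s^2-4}{1189c_s^2-828}\,\sigma_3+\frac{154}{1395}\,\frac{7a-1391}{89a-20680}\,\frac{725c_s^2-418}{1189c_s^2-828}\,a\,\sigma_4,\qquad \sigma_{11}=\sigma_{12}=\frac a{155}\,\sigma_4.$$ Then the equation is rotation invariant and equal to $$\partial_t\rho+\mathrm{div}J+\xi\Delta\mathrm{div}J+\eta\Delta^2\rho=0,$$ $$\partial_tJ+c_0^2\nabla\rho-\mu\Delta J-\zeta\nabla\mathrm{div}J+\chi\nabla\Delta\rho+\mu_4\Delta^2J+\zeta_4\nabla\mathrm{div}\Delta J=0$$ with $\xi=\frac{5\alpha-16}{1560}\Delta x^2$, $\eta=\frac{\alpha+28}{40560}(36\sigma_3+5\sigma_3\alpha-52\sigma_4)\lambda\Delta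 x^3$, $\mu=\frac25\sigma_4\lambda\Delta x$, $\zeta=-\frac1{130}\sigma_3(36+5\alpha)\lambda\Delta x$, $\chi=\frac{28+\alpha}{20280}(16-5\alpha+216\sigma_3^2-312\sigma_4^2+30\alpha\sigma_3^2)\lambda^2\Delta x^2$, $$\mu_4=\frac{\sigma_4\lambda\Delta x^3}{300\,\sigma_3(a-308)}\big(4483\sigma_4-5099\sigma_3-23a\sigma_4+25a\sigma_3-14784\sigma_3\sigma_4^2+48a\sigma_3\sigma_4^2\big),$$ $$\begin{aligned}\zeta_4=\frac{\lambda\Delta x^3}{56581200\,\sigma_3(89a-20680)}\big(&525433428a\sigma_3\sigma_4+576972000\alpha^2\sigma_3^2+18001526400\alpha\sigma_3^3\sigma_4+18001526400\alpha\sigma_3\sigma_4^3+65975a^2\alpha\sigma_3\sigma_4\\&+170558856a\sigma_4^2-334055628a\sigma_3^2-858312a^2\sigma_4^2-159243217380\sigma_3\sigma_4+75143778660\sigma_3^2+18001526400\alpha\sigma_3^2\sigma_4^2\\&-77472720a\alpha\sigma_3^3\sigma_4-77472720a\alpha\sigma_3^2\sigma_4^2-77472720a\alpha\sigma_3\sig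ma_4^3+504042739200\sigma_3\sigma_4^3+129610990080\sigma_3^3\sigma_4\\&+129610990080\sigma_3^2\sigma_4^2+858312a^2\sigma_3\sigma_4+22940190a\alpha\sigma_3\sigma_4+17841109925\alpha\sigma_3^2-65975a^2\alpha\sigma_4^2+13110175a\alpha\sigma_4^2\\&-3461832000\alpha^2\sigma_3^4-85853433600\alpha\sigma_3^4-2483100a\alpha^2\sigma_3^2-78263065a\alpha\sigma_3^2-438683351040\sigma_3^4+369485280a\alpha\sigma_3^4\\&+14898600a\alpha^2\sigma_3^4+1887950592a\sigma_3^4-557803584a\sigma_3^2\sigma_4^2-2169236160a\sigma_3\sigma_4^3-557803584a\sigma_3^3\sigma_4-8032585925\alpha\sigma_3\sigma_4\big).\end{aligned}$$ 5. *Positivity.* If $-28<\alpha\le-\frac{9432}{725}$ (equivalently $0<c_s^2\le\frac{418}{725}$) and $155<a<\frac{1391}7$, then for all $\sigma_3,\sigma_4>0$ the values of $\sigma_8$, $\sigma_{10}$ and $\sigma_{11}$ in item 4 are strictly positive. -/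

import Mathlib

open MvPolynomial

/-! ## Linear lattice Boltzmann schemes with multiple relaxation times -/

/-- Space differential operators with constant real coefficients in `d` variables: polynomials in
the symbols `X a = ∂_a`. -/
abbrev DiffOp (d : ℕ) := MvPolynomial (Fin d) ℝ

/-- The data of a linear multiple-relaxation-times lattice Boltzmann scheme with `d` space
dimensions, `N` conserved moments and `r` slave moments (so `q = N + r` discrete velocities). One
time step is: moments `m = M f`, relaxation `m* = J₀ m`, `f* = M⁻¹ m*`, and propagation
`f_j(x, t + Δt) = f*_j(x - v_j Δt, t)`. -/
structure LinearScheme (d N r : ℕ) where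
  /-- the discrete velocities `v_j` -/
  velocity : Fin (N + r) → Fin d → ℝ
  /-- the moment matrix `M` -/
  momentMatrix : Matrix (Fin (N + r)) (Fin (N + r)) ℝ
  /-- the relaxation parameters of the slave moments -/
  relax : Fin r → ℝ
  /-- the equilibrium `Y^eq = E W` of the slave moments -/
  E : Matrix (Fin r) (Fin N) ℝ

namespace LinearScheme

variable {d N r : ℕ} (L : LinearScheme d N r)

/-- The relaxation matrix `J₀`: conserved moments are unchanged, slave moments obey
`Y* = Y + S (E W - Y)` with `S = diag(relax)`. -/
noncomputable def collision : Matrix (Fin (N + r)) (Fin (N + r)) ℝ :=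
  Matrix.reindex finSumFinEquiv finSumFinEquiv
    (Matrix.fromBlocks 1 0 (Matrix.diagonal L.relax * L.E) (1 - Matrix.diagonal L.relax))

/-- The derivation matrix of order `n`: the coefficient of `Δtⁿ` in the Taylor expansion of one
time step `m(t + Δt) = ∑ₙ Δtⁿ (derivation n) m(t)`, namely
`(1/n!) ∑_{j,l} M_{kj} (M⁻¹)_{jl} (-∑_a v_j^a ∂_a)ⁿ (J₀)_{lp}`. -/
noncomputable def derivation (n : ℕ) : Matrix (Fin (N + r)) (Fin (N + r)) (DiffOp d) :=
  fun k p => C (1 / (n.factorial : ℝ)) *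
    ∑ j, ∑ l, C (L.momentMatrix k j) * C (L.momentMatrix⁻¹ j l) *
      (-∑ a, C (L.velocity j a) * X a) ^ n * C (L.collision l p)

/-- Upper left block of the derivation matrix. -/
noncomputable def blockA (n : ℕ) : Matrix (Fin N) (Fin N) (DiffOp d) :=
  (L.derivation n).submatrix (Fin.castAdd r) (Fin.castAdd r)

/-- Upper right block of the derivation matrix. -/
noncomputable def blockB (n : ℕ) : Matrix (Fin N) (Fin r) (DiffOp d) :=
  (L.derivation n).submatrix (Fin.castAdd r) (Fin.natAdd N)

/-- Lower left block of the derivation matrix. -/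
noncomputable def blockC (n : ℕ) : Matrix (Fin r) (Fin N) (DiffOp d) :=
  (L.derivation n).submatrix (Fin.natAdd N) (Fin.castAdd r)

/-- Lower right block of the derivation matrix. -/
noncomputable def blockD (n : ℕ) : Matrix (Fin r) (Fin r) (DiffOp d) :=
  (L.derivation n).submatrix (Fin.natAdd N) (Fin.natAdd N)

/-- If `∂_t W = (∑_ℓ Δt^ℓ 𝒜_ℓ) W`, this is the coefficient of `Δtⁿ` in the formal Taylor expansion
`W(t + Δt) = exp(Δt ∂_t) W(t)`. The formal variable of the power series is `Δt`. -/
noncomputable def timeShift (𝒜 : PowerSeries (Matrix (Fin N) (Fin N) (DiffOp d))) (n : ℕ) :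
    Matrix (Fin N) (Fin N) (DiffOp d) :=
  ∑ j ∈ Finset.range (n + 1),
    (1 / (j.factorial : ℝ)) • PowerSeries.coeff n ((PowerSeries.X * 𝒜) ^ j)

/-- The pair `(𝒜, β)` is the formal expansion of the scheme: inserting
`∂_t W = (∑_{ℓ ≥ 0} Δt^ℓ α_{ℓ+1}) W` (with `α_{ℓ+1} = coeff ℓ 𝒜`) and
`Y = (∑_{n ≥ 0} Δtⁿ β_n) W` into the Taylor expansion
`(W, Y)(t + Δt) = ∑ₙ Δtⁿ [A_n B_n; C_n D_n] (W, Y)(t)` of the scheme gives an identity at every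
order in `Δt`. -/
structure IsFormalExpansion (𝒜 : PowerSeries (Matrix (Fin N) (Fin N) (DiffOp d)))
    (β : ℕ → Matrix (Fin r) (Fin N) (DiffOp d)) : Prop where
  conserved : ∀ n, timeShift 𝒜 n =
    L.blockA n + ∑ p ∈ Finset.HasAntidiagonal.antidiagonal n, L.blockB p.1 * β p.2
  slave : ∀ n, ∑ p ∈ Finset.HasAntidiagonal.antidiagonal n, β p.1 * timeShift 𝒜 p.2 =
    L.blockC n + ∑ p ∈ Finset.HasAntidiagonal.antidiagonal n, L.blockD p.1 * β p.2

end LinearScheme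

/-- The space operator `-∑_{j=1}^{ℓ} Δt^{j-1} α_j` of the equivalent equation truncated at order
`ℓ`, which reads `∂_t W + (equivalentOperator 𝒜 Δt ℓ) W = O(Δt^ℓ)`. -/
noncomputable def equivalentOperator {d N : ℕ}
    (𝒜 : PowerSeries (Matrix (Fin N) (Fin N) (DiffOp d))) (dt : ℝ) (l : ℕ) :
    Matrix (Fin N) (Fin N) (DiffOp d) :=
  -∑ j ∈ Finset.range l, dt ^ j • PowerSeries.coeff j 𝒜

/-! ## Rotation invariance and acoustic type systems in the plane, for `W = (ρ, J_x, J_y)` -/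

/-- The action of the plane rotation of angle `θ` on `(ρ, J_x, J_y)`: scalar times vector. -/
noncomputable def rotationW (θ : ℝ) : Matrix (Fin 3) (Fin 3) ℝ :=
  !![1, 0, 0; 0, Real.cos θ, -Real.sin θ; 0, Real.sin θ, Real.cos θ]

/-- The action of the plane rotation of angle `θ` on `(∂_x, ∂_y)`. -/
noncomputable def rotationD (θ : ℝ) : DiffOp 2 →ₐ[ℝ] DiffOp 2 :=
  aeval ![C (Real.cos θ) * X 0 - C (Real.sin θ) * X 1,
    C (Real.sin θ) * X 0 + C (Real.cos θ) * X 1]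

/-- The system `∂_t W + P(∂) W = 0` is invariant by rotation: `P(R ∂) = R P(∂) R⁻¹` for every plane
rotation `R`, where `ρ` is transformed as a scalar and `J` as a vector. -/
def IsRotationInvariant (P : Matrix (Fin 3) (Fin 3) (DiffOp 2)) : Prop :=
  ∀ θ : ℝ, P.map (rotationD θ) =
    (rotationW θ).map C * P * (rotationW (-θ)).map C

/-- The Laplace operator `∂_x² + ∂_y²`. -/
noncomputable def lap : DiffOp 2 := X 0 ^ 2 + X 1 ^ 2

/-- `∂_t ρ + div J`, `∂_t J + c0² ∇ρ`. -/
noncomputable def acousticOrder1 (c0sq : ℝ) : Matrix (Fin 3) (Fin 3) (DiffOp 2) :=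
  !![0, X 0, X 1;
     C c0sq * X 0, 0, 0;
     C c0sq * X 1, 0, 0]

/-- `∂_t ρ + div J`, `∂_t J + c0² ∇ρ - μ Δ J - ζ ∇ div J`. -/
noncomputable def acousticOrder2 (c0sq μ ζ : ℝ) : Matrix (Fin 3) (Fin 3) (DiffOp 2) :=
  acousticOrder1 c0sq -
    !![0, 0, 0;
       0, C μ * lap + C ζ * X 0 ^ 2, C ζ * (X 0 * X 1);
       0, C ζ * (X 0 * X 1), C μ * lap + C ζ * X 1 ^ 2]

/-- `∂_t ρ + div J + ξ Δ div J`, `∂_t J + c0² ∇ρ - μ Δ J - ζ ∇ div J + χ ∇ Δ ρ`. -/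
noncomputable def acousticOrder3 (c0sq μ ζ ξ χ : ℝ) : Matrix (Fin 3) (Fin 3) (DiffOp 2) :=
  acousticOrder2 c0sq μ ζ +
    !![0, C ξ * (lap * X 0), C ξ * (lap * X 1);
       C χ * (X 0 * lap), 0, 0;
       C χ * (X 1 * lap), 0, 0]

/-- `∂_t ρ + div J + ξ Δ div J + η Δ² ρ`,
`∂_t J + c0² ∇ρ - μ Δ J - ζ ∇ div J + χ ∇ Δ ρ + μ4 Δ² J + ζ4 ∇ div Δ J`. -/
noncomputable def acousticOrder4 (c0sq μ ζ ξ χ η μ4 ζ4 : ℝ) :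
    Matrix (Fin 3) (Fin 3) (DiffOp 2) :=
  acousticOrder3 c0sq μ ζ ξ χ +
    !![C η * lap ^ 2, 0, 0;
       0, C μ4 * lap ^ 2 + C ζ4 * (X 0 ^ 2 * lap), C ζ4 * (X 0 * X 1 * lap);
       0, C ζ4 * (X 0 * X 1 * lap), C μ4 * lap ^ 2 + C ζ4 * (X 1 ^ 2 * lap)]

/-! ## The D2Q13 scheme -/

/-- The thirteen velocities of D2Q13, in units of `lam = Δx/Δt`: those of D2Q9, then the four
vectors of length two along the axes. -/
def d2q13Velocity (lam : ℝ) (j : Fin 13) : Fin 2 → ℝ :=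
  lam • (![![0, 0], ![1, 0], ![0, 1], ![-1, 0], ![0, -1],
    ![1, 1], ![-1, 1], ![-1, -1], ![1, -1],
    ![2, 0], ![0, 2], ![-2, 0], ![0, -2]] : Fin 13 → Fin 2 → ℝ) j

/-- The thirteen orthogonal moment polynomials of D2Q13, in the order
`1, X, Y, ε, XX, XY, q_x, q_y, r_x, r_y, ε₂, ε₃, XX_e`, at the velocity `(x, y)`. -/
noncomputable def d2q13Polynomial (lam x y : ℝ) : Fin 13 → ℝ :=
  ![1, x, y,
    13 * (x ^ 2 + y ^ 2) - 28 * lam ^ 2,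
    x ^ 2 - y ^ 2,
    x * y,
    x * (x ^ 2 + y ^ 2 - 3 * lam ^ 2),
    y * (x ^ 2 + y ^ 2 - 3 * lam ^ 2),
    x * (35 / 12 * (x ^ 2 + y ^ 2) ^ 2 - 63 / 4 * lam ^ 2 * (x ^ 2 + y ^ 2) + 101 / 6 * lam ^ 4),
    y * (35 / 12 * (x ^ 2 + y ^ 2) ^ 2 - 63 / 4 * lam ^ 2 * (x ^ 2 + y ^ 2) + 101 / 6 * lam ^ 4),
    77 / 2 * (x ^ 2 + y ^ 2) ^ 2 - 361 / 2 * lam ^ 2 * (x ^ 2 + y ^ 2) + 140 * lam ^ 4,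
    137 / 24 * (x ^ 2 + y ^ 2) ^ 3 - 273 / 8 * lam ^ 2 * (x ^ 2 + y ^ 2) ^ 2
      + 581 / 12 * lam ^ 4 * (x ^ 2 + y ^ 2) - 12 * lam ^ 6,
    (x ^ 2 - y ^ 2) * (17 / 12 * (x ^ 2 + y ^ 2) - 65 / 12 * lam ^ 2)]

/-- The moment matrix `M_{kj} = p_k(v_j)` of D2Q13. -/
noncomputable def d2q13Matrix (lam : ℝ) : Matrix (Fin 13) (Fin 13) ℝ :=
  fun k j => d2q13Polynomial lam (d2q13Velocity lam j 0) (d2q13Velocity lam j 1) k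

/-- The linear D2Q13 scheme. The relaxation parameters `s k` and the equilibria
`m_k^eq = G k 0 ρ + G k 1 J_x + G k 2 J_y` are numbered like the moments; only the indices
`k = 3, …, 12` are used. -/
noncomputable def d2q13 (lam : ℝ) (s : Fin 13 → ℝ) (G : Matrix (Fin 13) (Fin 3) ℝ) :
    LinearScheme 2 3 10 where
  velocity := d2q13Velocity lam
  momentMatrix := d2q13Matrix lam
  relax := fun l => s (Fin.natAdd 3 l)
  E := fun l i => G (Fin.natAdd 3 l) i

/-- `ε^eq = α lam² ρ`, `XX^eq = XY^eq = 0`. -/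
def SecondMomentsEquilibrium (lam α : ℝ) (G : Matrix (Fin 13) (Fin 3) ℝ) : Prop :=
  G 3 = ![α * lam ^ 2, 0, 0] ∧ G 4 = 0 ∧ G 5 = 0

/-- `q^eq = φ lam² J`, `r^eq = κ lam⁴ J`. -/
def FluxEquilibrium (lam φ κ : ℝ) (G : Matrix (Fin 13) (Fin 3) ℝ) : Prop :=
  G 6 = ![0, φ * lam ^ 2, 0] ∧ G 7 = ![0, 0, φ * lam ^ 2] ∧
  G 8 = ![0, κ * lam ^ 4, 0] ∧ G 9 = ![0, 0, κ * lam ^ 4]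

/-- `ε₂^eq = e₂ lam⁴ ρ`, `ε₃^eq = e₃ lam⁶ ρ`, `XX_e^eq = 0`. -/
def ScalarEquilibrium (lam e₂ e₃ : ℝ) (G : Matrix (Fin 13) (Fin 3) ℝ) : Prop :=
  G 10 = ![e₂ * lam ^ 4, 0, 0] ∧ G 11 = ![e₃ * lam ^ 6, 0, 0] ∧ G 12 = 0

/-- The coefficient of `r^eq` at second order. -/
noncomputable def rCoeff2 (φ σ4 σ5 : ℝ) : ℝ :=
  1 / 12 * ((20 * σ5 - 85 * σ4 - 49 * φ * σ4 - 14 * φ * σ5) / (σ4 + σ5))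

/-- The coefficient of `r^eq` at third order. -/
noncomputable def rCoeff3 (φ : ℝ) : ℝ := -(1 / 24) * (65 + 63 * φ)

/-- The coefficient of `ε₂^eq` at third order. -/
noncomputable def eps2Coeff (α φ : ℝ) : ℝ := -5 * α + 77 / 26 * φ * α + 1078 / 13 * φ

/-- The coefficient of `ε₃^eq` at third order. -/
noncomputable def eps3Coeff (α φ : ℝ) : ℝ :=
  α / 48 - 137 / 12 - 135 / 208 * α * φ - 945 / 52 * φ

/-- The square `c_s²` of the sound velocity divided by `lam²`. -/
noncomputable def csq (α : ℝ) : ℝ := (28 + α) / 26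

/-- The value of `σ₈ = σ₉` at fourth order. -/
noncomputable def sigma8 (a σ3 σ4 : ℝ) : ℝ :=
  5 / 24 * ((155 - a) / (a - 308)) * (1 / σ4) + 1 / 24 * ((7 * a - 1391) / (a - 308)) * (1 / σ3)

/-- The value of `σ₁₀` at fourth order. -/
noncomputable def sigma10 (α a σ3 σ4 : ℝ) : ℝ :=
  3973 / 45 * ((43 * a - 16610) / (89 * a - 20680))
      * ((5 * csq α - 4) / (1189 * csq α - 828)) * σ3
    + 154 / 1395 * ((7 * a - 1391) / (89 * a - 20680))
      * ((725 * csq α - 418) / (1189 * csq α - 828)) * a * σ4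

/-- The value of `σ₁₁ = σ₁₂` at fourth order. -/
noncomputable def sigma11 (a σ4 : ℝ) : ℝ := a / 155 * σ4

/-- The coefficient `χ` at third order. -/
noncomputable def chi3 (lam dx α φ σ3 σ4 : ℝ) : ℝ :=
  1 / 8112 * (28 + α) *
    (61 + 39 * φ + 12 * α * σ3 ^ 2 - 2 * α - 78 * φ * σ4 ^ 2 - 156 * φ * σ3 ^ 2
      - 234 * σ4 ^ 2 - 132 * σ3 ^ 2) * lam ^ 2 * dx ^ 2

/-- The coefficient `χ` at fourth order. -/
noncomputable def chi4 (lam dx α σ3 σ4 : ℝ) : ℝ :=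
  1 / 20280 * (28 + α) *
    (16 - 5 * α + 216 * σ3 ^ 2 - 312 * σ4 ^ 2 + 30 * α * σ3 ^ 2) * lam ^ 2 * dx ^ 2

/-- The coefficient `η` at fourth order. -/
noncomputable def eta4 (lam dx α σ3 σ4 : ℝ) : ℝ :=
  (α + 28) / 40560 * (36 * σ3 + 5 * σ3 * α - 52 * σ4) * lam * dx ^ 3

/-- The coefficient `μ₄` at fourth order. -/
noncomputable def mu4 (lam dx a σ3 σ4 : ℝ) : ℝ :=
  σ4 * lam * dx ^ 3 / (300 * σ3 * (a - 308)) *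
    (4483 * σ4 - 5099 * σ3 - 23 * a * σ4 + 25 * a * σ3
      - 14784 * σ3 * σ4 ^ 2 + 48 * a * σ3 * σ4 ^ 2)

/-- The coefficient `ζ₄` at fourth order. -/
noncomputable def zeta4 (lam dx α a σ3 σ4 : ℝ) : ℝ :=
  lam * dx ^ 3 / (56581200 * σ3 * (89 * a - 20680)) *
    (525433428 * a * σ3 * σ4 + 576972000 * α ^ 2 * σ3 ^ 2
      + 18001526400 * α * σ3 ^ 3 * σ4 + 18001526400 * α * σ3 * σ4 ^ 3
      + 65975 * a ^ 2 * α * σ3 * σ4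
      + 170558856 * a * σ4 ^ 2 - 334055628 * a * σ3 ^ 2 - 858312 * a ^ 2 * σ4 ^ 2
      - 159243217380 * σ3 * σ4
      + 75143778660 * σ3 ^ 2 + 18001526400 * α * σ3 ^ 2 * σ4 ^ 2
      - 77472720 * a * α * σ3 ^ 3 * σ4
      - 77472720 * a * α * σ3 ^ 2 * σ4 ^ 2 - 77472720 * a * α * σ3 * σ4 ^ 3
      + 504042739200 * σ3 * σ4 ^ 3
      + 129610990080 * σ3 ^ 3 * σ4 + 129610990080 * σ3 ^ 2 * σ4 ^ 2
      + 858312 * a ^ 2 * σ3 * σ4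
      + 22940190 * a * α * σ3 * σ4 + 17841109925 * α * σ3 ^ 2 - 65975 * a ^ 2 * α * σ4 ^ 2
      + 13110175 * a * α * σ4 ^ 2 - 3461832000 * α ^ 2 * σ3 ^ 4
      - 85853433600 * α * σ3 ^ 4
      - 2483100 * a * α ^ 2 * σ3 ^ 2 - 78263065 * a * α * σ3 ^ 2
      - 438683351040 * σ3 ^ 4
      + 369485280 * a * α * σ3 ^ 4 + 14898600 * a * α ^ 2 * σ3 ^ 4
      + 1887950592 * a * σ3 ^ 4
      - 557803584 * a * σ3 ^ 2 * σ4 ^ 2 - 2169236160 * a * σ3 * σ4 ^ 3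
      - 557803584 * a * σ3 ^ 3 * σ4
      - 8032585925 * α * σ3 * σ4)

/-! The expansion is determined recursively. Collision fixes the conserved moments, so the order-n
part of the conserved equation involves only slave coefficients of order below n. The slave equation
at order n then reads S β_n = known terms, with S the invertible diagonal of the relaxation
parameters. The time derivative is recovered by a formal logarithm.

To compute it, let V be the advection operator v·∂ written in the basis of moments, Ψ the series of
moments, J the collision, and D the sum of left multiplication by V and right multiplication by the
series of ∂_t. The scheme says exp(Δt D) Ψ = JΨ. With Z = JΨ - Ψ = m* - m this gives Δt D(Ψ + Z/2) =
(Δt D/2) coth(Δt D/2) Z = Z + (Δt D)² Z/12 + ..., and the next term of the series plays no role up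
to order four. Relaxation gives Ψ + Z/2 = -σZ on slave moments beyond order zero, which is why only
σ = 1/s - 1/2 appears. The conserved rows of Z vanish, and these rows of each relation are explicit
formulas for α_1, ..., α_4 (`exp_relations`, `IsFormalExpansion.chapmanEnskog`).

A constant-coefficient operator is known from the values of its symbol, so for D2Q13 everything
reduces to real matrices at a point (x, y). There V is the sparse matrix `d2q13Flux`, which couples
each moment to few others. Each further order thus brings in moments one step farther from ρ and J:
second moments in α_2, the fluxes q, r and then ε₂, ε₃, XX_e in α_3 and α_4.

Symmetry of the velocity set under the square leaves a few scalar coefficients at each order, and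
isotropy is a set of equations between them. The prescribed equilibria and relaxation parameters
solve these equations. At fourth order five coefficients must match two, μ₄ and ζ₄
(`fourthOrder_coefficients`). Rotation invariance follows from the form of the resulting system,
built from Δ, ∇ and div. -/

/-! ## Existence and uniqueness of the formal expansion -/

/-- A sequence defined by a recursion in which every term depends on the previous ones exists and
is unique. -/
theorem existsUnique_of_causal {Y : Type*} [Inhabited Y] (F : ℕ → (ℕ → Y) → Y)
    (hF : ∀ n g h, (∀ m < n, g m = h m) → F n g = F n h) : ∃! x : ℕ → Y, ∀ n, x n = F n x := by
  classical
  -- The recursion only supplies values below n. The other arguments of F are filled with `default`,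
  -- which is harmless because F n does not look at them.
  let step : (n : ℕ) → ((m : ℕ) → m < n → Y) → Y := fun n f =>
    F n fun m => if h : m < n then f m h else default
  refine ⟨fun n => WellFounded.fix Nat.lt_wfRel.wf step n, fun n => ?_, fun x hx => ?_⟩
  · beta_reduce
    rw [WellFounded.fix_eq]
    refine hF n _ _ fun m hm => ?_
    simp only [hm, dite_true]
  · funext n
    induction n using Nat.strong_induction_on with
    | _ n ih =>
      rw [hx n, WellFounded.fix_eq]
      refine hF n _ _ fun m hm => ?_
      simp only [hm, dite_true]
      exact ih m hm

theorem PowerSeries.coeff_pow_congr {R : Type*} [Semiring R] {f g : PowerSeries R} {n : ℕ}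
    (h : ∀ m ≤ n, coeff m f = coeff m g) (j : ℕ) : coeff n (f ^ j) = coeff n (g ^ j) := by
  induction j generalizing n with
  | zero => simp
  | succ j ih =>
    rw [pow_succ, pow_succ, coeff_mul, coeff_mul]
    refine Finset.sum_congr rfl fun p hp => ?_
    have hp' := Finset.HasAntidiagonal.mem_antidiagonal.1 hp
    rw [ih fun m hm => h m (by omega), h p.2 (by omega)]

namespace LinearScheme

variable {d N r : ℕ} (L : LinearScheme d N r)

/-- The factor X^(j+2) lowers the degree by at least two, so a coefficient of order n + 1 only
reaches coefficients of the base of order below n. The coefficient ring is a noncommutative matrix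
ring, but X is central. -/
theorem coeff_X_mul_pow_congr {R : Type*} [Semiring R] {f g : PowerSeries R} {n : ℕ}
    (h : ∀ m < n, PowerSeries.coeff m f = PowerSeries.coeff m g) (j : ℕ) :
    PowerSeries.coeff (n + 1) ((PowerSeries.X * f) ^ (j + 2)) =
      PowerSeries.coeff (n + 1) ((PowerSeries.X * g) ^ (j + 2)) := by
  have key : ∀ f : PowerSeries R, PowerSeries.coeff (n + 1) ((PowerSeries.X * f) ^ (j + 2)) =
      if j + 2 ≤ n + 1 then PowerSeries.coeff (n + 1 - (j + 2)) (f ^ (j + 2)) else 0 := by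
    intro f
    rw [(PowerSeries.commute_X f).symm.mul_pow, PowerSeries.coeff_X_pow_mul']
  rw [key, key]
  split_ifs with hj
  · exact PowerSeries.coeff_pow_congr (fun m hm => h m (by omega)) _
  · rfl

theorem timeShift_zero (𝒜 : PowerSeries (Matrix (Fin N) (Fin N) (DiffOp d))) :
    timeShift 𝒜 0 = 1 := by
  simp [timeShift]

/-- Isolates the newest unknown: the linear term of the exponential contributes `coeff n 𝒜`, and
every higher power involves earlier coefficients only. -/
theorem timeShift_succ (𝒜 : PowerSeries (Matrix (Fin N) (Fin N) (DiffOp d))) (n : ℕ) :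
    timeShift 𝒜 (n + 1) = PowerSeries.coeff n 𝒜 + ∑ j ∈ Finset.range n,
      (1 / ((j + 2).factorial : ℝ)) •
        PowerSeries.coeff (n + 1) ((PowerSeries.X * 𝒜) ^ (j + 2)) := by
  rw [timeShift, Finset.sum_range_succ', Finset.sum_range_succ']
  simp [add_comm _ (PowerSeries.coeff n 𝒜), add_assoc]

/-- The formal logarithm: every sequence starting with `1` is the expansion of a unique formal
`exp(Δt ∂_t)`. -/
theorem existsUnique_timeShift_eq (T : ℕ → Matrix (Fin N) (Fin N) (DiffOp d)) (hT : T 0 = 1) :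
    ∃! 𝒜 : PowerSeries (Matrix (Fin N) (Fin N) (DiffOp d)), ∀ n, timeShift 𝒜 n = T n := by
  have h := existsUnique_of_causal
    (F := fun n (g : ℕ → Matrix (Fin N) (Fin N) (DiffOp d)) => T (n + 1) - ∑ j ∈ Finset.range n,
      (1 / ((j + 2).factorial : ℝ)) •
        PowerSeries.coeff (n + 1) ((PowerSeries.X * PowerSeries.mk g) ^ (j + 2)))
    (by
      intro n g h hgh
      refine congrArg (T (n + 1) - ·) (Finset.sum_congr rfl fun j _ => ?_)
      rw [coeff_X_mul_pow_congr (f := PowerSeries.mk g) (g := PowerSeries.mk h)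
        (fun m hm => by simpa using hgh m hm)])
  obtain ⟨x, hx, hu⟩ := h
  have iff : ∀ y : ℕ → Matrix (Fin N) (Fin N) (DiffOp d),
      (∀ n, timeShift (PowerSeries.mk y) n = T n) ↔ ∀ n, y n = T (n + 1) - ∑ j ∈ Finset.range n,
      (1 / ((j + 2).factorial : ℝ)) •
        PowerSeries.coeff (n + 1) ((PowerSeries.X * PowerSeries.mk y) ^ (j + 2)) := by
    intro y
    constructor
    · intro h n
      rw [← h, timeShift_succ]
      simp
    · rintro h (_ | n)
      · rw [timeShift_zero, hT]
      · rw [timeShift_succ, PowerSeries.coeff_mk, h n, sub_add_cancel]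
  refine ⟨PowerSeries.mk x, (iff x).2 hx, fun 𝒜 h𝒜 => ?_⟩
  have h𝒜' : 𝒜 = PowerSeries.mk fun n => PowerSeries.coeff n 𝒜 := by ext1 n; simp
  rw [h𝒜'] at h𝒜 ⊢
  rw [hu _ ((iff _).1 h𝒜)]

theorem derivation_zero (hM : IsUnit L.momentMatrix.det) :
    L.derivation 0 = L.collision.map C := by
  ext1 k p
  have h : ∀ l, ∑ j, L.momentMatrix k j * L.momentMatrix⁻¹ j l = (1 : Matrix _ _ ℝ) k l := by
    intro l
    rw [← Matrix.mul_nonsing_inv _ hM, Matrix.mul_apply]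
  simp only [derivation, pow_zero, mul_one, Nat.factorial_zero, Nat.cast_one, one_div, inv_one,
    C_1, one_mul, Matrix.map_apply]
  rw [Finset.sum_comm]
  simp only [← C_mul, ← map_sum, ← Finset.sum_mul, h]
  simp [Matrix.one_apply]

theorem blockA_zero (hM : IsUnit L.momentMatrix.det) : L.blockA 0 = 1 := by
  ext1 i j
  simp [blockA, L.derivation_zero hM, collision, Matrix.one_apply, apply_ite (C (σ := Fin d))]

/-- This is what makes the conserved equation causal: the slave coefficient of order n drops out of
its order n part. -/
theorem blockB_zero (hM : IsUnit L.momentMatrix.det) : L.blockB 0 = 0 := by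
  ext1 i j
  simp [blockB, L.derivation_zero hM, collision]

theorem blockD_zero (hM : IsUnit L.momentMatrix.det) :
    L.blockD 0 = 1 - Matrix.diagonal fun l => C (L.relax l) := by
  ext1 i j
  simp [blockD, L.derivation_zero hM, collision, Matrix.one_apply, Matrix.diagonal_apply,
    apply_ite (C (σ := Fin d))]

/-- Solves the slave equation for its newest coefficient b, which occurs on both sides, once bare
and once through the zeroth block 1 - D. The inverse D' is given explicitly because the entries lie
in a polynomial ring. -/
theorem add_eq_add_one_sub_mul_iff {m n R : Type*} [Fintype m] [DecidableEq m] [Ring R]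
    {D D' : Matrix m m R} (hDD' : D * D' = 1) (hD'D : D' * D = 1) (b u v w : Matrix m n R) :
    u + b = v + (w + (1 - D) * b) ↔ b = D' * (v + w - u) := by
  have h1 : u + b = v + (w + (1 - D) * b) ↔ D * b = v + w - u := by
    rw [Matrix.sub_mul, Matrix.one_mul, ← sub_eq_zero, ← sub_eq_zero (a := D * b)]
    refine Eq.congr_left ?_
    abel
  rw [h1]
  constructor
  · intro h
    rw [← h, ← Matrix.mul_assoc, hD'D, Matrix.one_mul]
  · intro h
    rw [h, ← Matrix.mul_assoc, hDD', Matrix.one_mul]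

/-- The formal expansion of a scheme with invertible moment matrix and nonzero relaxation
parameters exists and is unique. -/
theorem existsUnique_isFormalExpansion (hM : IsUnit L.momentMatrix.det)
    (hs : ∀ l, L.relax l ≠ 0) :
    ∃! p : PowerSeries (Matrix (Fin N) (Fin N) (DiffOp d)) ×
      (ℕ → Matrix (Fin r) (Fin N) (DiffOp d)), L.IsFormalExpansion p.1 p.2 := by
  let T : (ℕ → Matrix (Fin r) (Fin N) (DiffOp d)) → ℕ → Matrix (Fin N) (Fin N) (DiffOp d) :=
    fun β n => L.blockA n + ∑ p ∈ Finset.HasAntidiagonal.antidiagonal n, L.blockB p.1 * β p.2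
  have hT0 : ∀ β, T β 0 = 1 := by
    intro β
    simp [T, L.blockA_zero hM, L.blockB_zero hM]
  have hT : ∀ n β β', (∀ m < n, β m = β' m) → T β n = T β' n := by
    intro n β β' h
    refine congrArg (L.blockA n + ·) (Finset.sum_congr rfl fun p hp => ?_)
    have hp' := Finset.HasAntidiagonal.mem_antidiagonal.1 hp
    rcases Nat.eq_zero_or_pos p.1 with h0 | h0
    · simp [h0, L.blockB_zero hM]
    · rw [h p.2 (by omega)]
  let D : Matrix (Fin r) (Fin r) (DiffOp d) := Matrix.diagonal fun l => C (L.relax l)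
  let D' : Matrix (Fin r) (Fin r) (DiffOp d) := Matrix.diagonal fun l => C (L.relax l)⁻¹
  have hDD' : D * D' = 1 := by
    simp only [D, D', Matrix.diagonal_mul_diagonal, ← C_mul, mul_inv_cancel₀ (hs _), C_1]
    exact Matrix.diagonal_one
  have hD'D : D' * D = 1 := by
    simp only [D, D', Matrix.diagonal_mul_diagonal, ← C_mul, inv_mul_cancel₀ (hs _), C_1]
    exact Matrix.diagonal_one
  -- The order n slave equation solved for β n. The time shifts T β (n - k) with k < n only involve
  -- coefficients of β of order below n.
  let F : ℕ → (ℕ → Matrix (Fin r) (Fin N) (DiffOp d)) → Matrix (Fin r) (Fin N) (DiffOp d) :=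
    fun n β => D' * (L.blockC n + ∑ k ∈ Finset.range n, L.blockD (n - k) * β k
      - ∑ k ∈ Finset.range n, β k * T β (n - k))
  have hF : ∀ n β β', (∀ m < n, β m = β' m) → F n β = F n β' := by
    intro n β β' h
    have h1 : ∑ k ∈ Finset.range n, L.blockD (n - k) * β k =
        ∑ k ∈ Finset.range n, L.blockD (n - k) * β' k :=
      Finset.sum_congr rfl fun k hk => by rw [h k (Finset.mem_range.1 hk)]
    have h2 : ∑ k ∈ Finset.range n, β k * T β (n - k) =
        ∑ k ∈ Finset.range n, β' k * T β' (n - k) :=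
      Finset.sum_congr rfl fun k hk => by
        rw [h k (Finset.mem_range.1 hk), hT (n - k) β β' fun m hm => h m (by omega)]
    simp only [F, h1, h2]
  have hslave : ∀ β n,
      (∑ p ∈ Finset.HasAntidiagonal.antidiagonal n, β p.1 * T β p.2 =
        L.blockC n + ∑ p ∈ Finset.HasAntidiagonal.antidiagonal n, L.blockD p.1 * β p.2) ↔
      β n = F n β := by
    intro β n
    -- The antidiagonal on the right is swapped so that both sums run over the index of β. The last
    -- summands are then β n times `timeShift` at 0, which is 1, and (1 - D) β n.
    rw [Finset.Nat.sum_antidiagonal_eq_sum_range_succ fun i j => β i * T β j,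
      ← Finset.Nat.sum_antidiagonal_swap]
    simp only [Prod.fst_swap, Prod.snd_swap]
    rw [Finset.Nat.sum_antidiagonal_eq_sum_range_succ fun i j => L.blockD j * β i,
      Finset.sum_range_succ, Finset.sum_range_succ, Nat.sub_self, hT0, L.blockD_zero hM,
      Matrix.mul_one]
    exact add_eq_add_one_sub_mul_iff hDD' hD'D _ _ _ _
  obtain ⟨β, hβ, huβ⟩ := existsUnique_of_causal F hF
  obtain ⟨𝒜, h𝒜, hu𝒜⟩ := existsUnique_timeShift_eq (T β) (hT0 β)
  refine ⟨(𝒜, β), ⟨h𝒜, fun n => ?_⟩, ?_⟩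
  · simp only [h𝒜]
    exact (hslave β n).2 (hβ n)
  · rintro ⟨𝒜', β'⟩ ⟨hc, hsl⟩
    have hc' : ∀ n, timeShift 𝒜' n = T β' n := hc
    simp only [hc'] at hsl
    obtain rfl : β' = β := huβ β' fun n => (hslave β' n).1 (hsl n)
    rw [hu𝒜 𝒜' hc']

/-! ## The Chapman-Enskog relations up to order four -/

/-- The advection operator `v · ∂` in the basis of moments. -/
noncomputable def advection : Matrix (Fin (N + r)) (Fin (N + r)) (DiffOp d) :=
  L.momentMatrix.map C * Matrix.diagonal (fun j => ∑ a, C (L.velocity j a) * X a) *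
    L.momentMatrix⁻¹.map C

theorem advection_pow (hM : IsUnit L.momentMatrix.det) (n : ℕ) :
    L.advection ^ n = L.momentMatrix.map C *
      Matrix.diagonal (fun j => (∑ a, C (L.velocity j a) * X a) ^ n) *
      L.momentMatrix⁻¹.map (C (σ := Fin d)) := by
  have h1 : L.momentMatrix.map (C (σ := Fin d)) * L.momentMatrix⁻¹.map C = 1 := by
    rw [← Matrix.map_mul, Matrix.mul_nonsing_inv _ hM, Matrix.map_one _ (map_zero C) (map_one C)]
  have h2 : L.momentMatrix⁻¹.map (C (σ := Fin d)) * L.momentMatrix.map C = 1 := by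
    rw [← Matrix.map_mul, Matrix.nonsing_inv_mul _ hM, Matrix.map_one _ (map_zero C) (map_one C)]
  induction n with
  | zero =>
    simp only [pow_zero]
    rw [show (Matrix.diagonal fun _ : Fin (N + r) => (1 : DiffOp d)) = 1 from Matrix.diagonal_one,
      mul_one, h1]
  | succ n ih =>
    rw [pow_succ, ih, advection]
    simp only [Matrix.mul_assoc]
    rw [← Matrix.mul_assoc _ (L.momentMatrix.map C), h2, Matrix.one_mul,
      ← Matrix.mul_assoc (Matrix.diagonal _), Matrix.diagonal_mul_diagonal]
    simp only [pow_succ]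

/-- Propagation is diagonal in the basis of velocities, hence conjugation by M turns the Taylor
coefficients of one time step into those of exp(-Δt V) J. -/
theorem derivation_eq (hM : IsUnit L.momentMatrix.det) (n : ℕ) :
    L.derivation n = (1 / (n.factorial : ℝ)) • ((-L.advection) ^ n * L.collision.map C) := by
  ext1 k p
  rw [neg_pow, L.advection_pow hM, derivation, Matrix.smul_apply, smul_eq_C_mul]
  congr 1
  have hneg : ((-1) ^ n : Matrix (Fin (N + r)) (Fin (N + r)) (DiffOp d)) =
      Matrix.diagonal fun _ => (-1) ^ n := by
    rw [show (-1 : Matrix (Fin (N + r)) (Fin (N + r)) (DiffOp d)) =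
      Matrix.diagonal fun _ => (-1) by rw [← Matrix.diagonal_one, Matrix.diagonal_neg],
      Matrix.diagonal_pow]
    rfl
  rw [hneg, Matrix.mul_assoc, Matrix.diagonal_mul, Matrix.mul_assoc, Matrix.mul_assoc,
    Matrix.mul_apply, Finset.mul_sum]
  refine Finset.sum_congr rfl fun j _ => ?_
  rw [Matrix.diagonal_mul, Matrix.mul_apply, Finset.mul_sum, Finset.mul_sum, Finset.mul_sum]
  refine Finset.sum_congr rfl fun l _ => ?_
  rw [neg_pow]
  simp only [Matrix.map_apply]
  ring

/-- The moments `(W, Y) = (∑ₙ Δtⁿ Φₙ) W`. -/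
noncomputable def momentSeries (β : ℕ → Matrix (Fin r) (Fin N) (DiffOp d)) (n : ℕ) :
    Matrix (Fin (N + r)) (Fin N) (DiffOp d) :=
  fun k => Fin.addCases (fun i => if n = 0 then (1 : Matrix _ _ (DiffOp d)) i else 0)
    (fun l => β n l) k

/-- Joins the conserved and slave equations into the single identity Ψ exp(Δt ∂_t) = exp(-Δt V) J Ψ,
read at order n. -/
theorem IsFormalExpansion.sum_momentSeries {L : LinearScheme d N r}
    {𝒜 : PowerSeries (Matrix (Fin N) (Fin N) (DiffOp d))}
    {β : ℕ → Matrix (Fin r) (Fin N) (DiffOp d)} (h : L.IsFormalExpansion 𝒜 β) (n : ℕ) :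
    ∑ p ∈ Finset.HasAntidiagonal.antidiagonal n, momentSeries β p.1 * timeShift 𝒜 p.2 =
      ∑ p ∈ Finset.HasAntidiagonal.antidiagonal n, L.derivation p.1 * momentSeries β p.2 := by
  have key : ∀ (k : Fin (N + r)) (i : Fin N),
      (∑ p ∈ Finset.HasAntidiagonal.antidiagonal n, L.derivation p.1 * momentSeries β p.2) k i =
      L.derivation n k (Fin.castAdd r i) + ∑ p ∈ Finset.HasAntidiagonal.antidiagonal n,
        ∑ l, L.derivation p.1 k (Fin.natAdd N l) * β p.2 l i := by
    intro k i
    rw [Matrix.sum_apply]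
    simp only [Matrix.mul_apply, Fin.sum_univ_add, momentSeries, Fin.addCases_left,
      Fin.addCases_right, Finset.sum_add_distrib]
    congr 1
    -- The conserved rows of the moment series are the identity at order zero and vanish afterwards.
    rw [Finset.sum_eq_single (n, 0)]
    · simp [Matrix.one_apply]
    · rintro ⟨a, b⟩ hp hne
      have hb : b ≠ 0 := by
        rintro rfl
        exact hne (by simpa using hp)
      simp [hb]
    · simp
  ext1 k i
  rw [key]
  induction k using Fin.addCases with
  | left k =>
    have := congrFun (congrFun (h.conserved n) k) i
    simp only [Matrix.add_apply, Matrix.sum_apply, Matrix.mul_apply, blockA, blockB,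
      Matrix.submatrix_apply] at this
    rw [← this, Matrix.sum_apply, Finset.sum_eq_single (0, n)]
    · simp [Matrix.mul_apply, momentSeries, Matrix.one_apply]
    · rintro ⟨a, b⟩ hp hne
      have hb : a ≠ 0 := by
        rintro rfl
        exact hne (by simpa using hp)
      simp [Matrix.mul_apply, momentSeries, hb]
    · simp
  | right k =>
    have := congrFun (congrFun (h.slave n) k) i
    simp only [Matrix.add_apply, Matrix.sum_apply, Matrix.mul_apply, blockC, blockD,
      Matrix.submatrix_apply] at this
    rw [← this, Matrix.sum_apply]
    simp [Matrix.mul_apply, momentSeries]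

/-! ### The first coefficients of the formal exponential -/

section TimeShift

variable (𝒜 : PowerSeries (Matrix (Fin N) (Fin N) (DiffOp d)))

local notation "c" => fun n : ℕ => PowerSeries.coeff n 𝒜

theorem timeShift_one : timeShift 𝒜 1 = c 0 := by
  simp [timeShift_succ 𝒜 0]

theorem timeShift_two : timeShift 𝒜 2 = c 1 + (1 / 2 : ℝ) • (c 0 * c 0) := by
  simp [timeShift_succ 𝒜 1, pow_succ, PowerSeries.coeff_mul, Finset.Nat.antidiagonal_succ,
    PowerSeries.coeff_X]

theorem timeShift_three : timeShift 𝒜 3 = c 2 + (1 / 2 : ℝ) • (c 0 * c 1 + c 1 * c 0) +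
    (1 / 6 : ℝ) • (c 0 * c 0 * c 0) := by
  simp [timeShift_succ 𝒜 2, Finset.sum_range_succ, pow_succ, PowerSeries.coeff_mul,
    Finset.Nat.antidiagonal_succ, Nat.factorial, mul_add, add_mul, mul_assoc, PowerSeries.coeff_X]
  module

theorem timeShift_four : timeShift 𝒜 4 = c 3 +
    (1 / 2 : ℝ) • (c 0 * c 2 + c 1 * c 1 + c 2 * c 0) +
    (1 / 6 : ℝ) • (c 0 * c 0 * c 1 + c 0 * c 1 * c 0 + c 1 * c 0 * c 0) +
    (1 / 24 : ℝ) • (c 0 * c 0 * c 0 * c 0) := by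
  simp [timeShift_succ 𝒜 3, Finset.sum_range_succ, pow_succ, PowerSeries.coeff_mul,
    Finset.Nat.antidiagonal_succ, Nat.factorial, mul_add, add_mul, mul_assoc, PowerSeries.coeff_X]
  module

end TimeShift

/-- With D X = V X + X a, the hypotheses are the first orders of (exp(Δt D) - 1) Φ = Z. Dividing by
exp(Δt D) - 1 gives Δt D(Φ + Z/2) = (Δt D/2) coth(Δt D/2) Z, an even series in D starting with 1 +
(Δt D)²/12. This is the source of the constants 1/2 and 1/12 and of the absence of other corrections
at these orders. -/
theorem exp_relations {m n R : Type*} [Fintype m] [DecidableEq m] [Fintype n] [DecidableEq n]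
    [CommRing R] [Algebra ℝ R] (V J : Matrix m m R) (Φ z : ℕ → Matrix m n R)
    (a₀ a₁ a₂ a₃ : Matrix n n R) (hz : ∀ n, J * Φ (n + 1) = Φ (n + 1) + z n)
    (h0 : Φ 0 = J * Φ 0)
    (h1 : Φ 0 * a₀ + Φ 1 = J * Φ 1 - V * (J * Φ 0))
    (h2 : Φ 0 * (a₁ + (1 / 2 : ℝ) • (a₀ * a₀)) + Φ 1 * a₀ + Φ 2 =
      J * Φ 2 - V * (J * Φ 1) + (1 / 2 : ℝ) • (V * (V * (J * Φ 0))))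
    (h3 : Φ 0 * (a₂ + (1 / 2 : ℝ) • (a₀ * a₁ + a₁ * a₀) + (1 / 6 : ℝ) • (a₀ * a₀ * a₀)) +
        Φ 1 * (a₁ + (1 / 2 : ℝ) • (a₀ * a₀)) + Φ 2 * a₀ + Φ 3 =
      J * Φ 3 - V * (J * Φ 2) + (1 / 2 : ℝ) • (V * (V * (J * Φ 1))) -
        (1 / 6 : ℝ) • (V * (V * (V * (J * Φ 0)))))
    (h4 : Φ 0 * (a₃ + (1 / 2 : ℝ) • (a₀ * a₂ + a₁ * a₁ + a₂ * a₀) +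
        (1 / 6 : ℝ) • (a₀ * a₀ * a₁ + a₀ * a₁ * a₀ + a₁ * a₀ * a₀) +
        (1 / 24 : ℝ) • (a₀ * a₀ * a₀ * a₀)) +
        Φ 1 * (a₂ + (1 / 2 : ℝ) • (a₀ * a₁ + a₁ * a₀) + (1 / 6 : ℝ) • (a₀ * a₀ * a₀)) +
        Φ 2 * (a₁ + (1 / 2 : ℝ) • (a₀ * a₀)) + Φ 3 * a₀ + Φ 4 =
      J * Φ 4 - V * (J * Φ 3) + (1 / 2 : ℝ) • (V * (V * (J * Φ 2))) -
        (1 / 6 : ℝ) • (V * (V * (V * (J * Φ 1)))) +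
        (1 / 24 : ℝ) • (V * (V * (V * (V * (J * Φ 0)))))) :
    z 0 = V * Φ 0 + Φ 0 * a₀ ∧
    z 1 = V * (Φ 1 + (1 / 2 : ℝ) • z 0) + (Φ 1 + (1 / 2 : ℝ) • z 0) * a₀ + Φ 0 * a₁ ∧
    z 2 = V * (Φ 2 + (1 / 2 : ℝ) • z 1) + (Φ 2 + (1 / 2 : ℝ) • z 1) * a₀ +
      (Φ 1 + (1 / 2 : ℝ) • z 0) * a₁ + Φ 0 * a₂ -
      (1 / 12 : ℝ) • (V * (V * z 0 + z 0 * a₀) + (V * z 0 + z 0 * a₀) * a₀) ∧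
    z 3 = V * (Φ 3 + (1 / 2 : ℝ) • z 2) + (Φ 3 + (1 / 2 : ℝ) • z 2) * a₀ +
      (Φ 2 + (1 / 2 : ℝ) • z 1) * a₁ + (Φ 1 + (1 / 2 : ℝ) • z 0) * a₂ + Φ 0 * a₃ -
      (1 / 12 : ℝ) • (V * (V * z 1 + z 1 * a₀) + (V * z 1 + z 1 * a₀) * a₀ +
        (V * (z 0 * a₁) + z 0 * a₁ * a₀) + (V * z 0 + z 0 * a₀) * a₁) := by
  have r0 : z 0 = V * Φ 0 + Φ 0 * a₀ := by
    rw [hz, ← h0] at h1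
    linear_combination (norm := module) -h1
  have r1 : z 1 = Φ 0 * (a₁ + (1 / 2 : ℝ) • (a₀ * a₀)) + Φ 1 * a₀ + V * (Φ 1 + z 0) -
      (1 / 2 : ℝ) • (V * (V * Φ 0)) := by
    rw [hz 0, hz 1, ← h0] at h2
    linear_combination (norm := module) -h2
  have r2 : z 2 = Φ 0 * (a₂ + (1 / 2 : ℝ) • (a₀ * a₁ + a₁ * a₀) + (1 / 6 : ℝ) • (a₀ * a₀ * a₀)) +
      Φ 1 * (a₁ + (1 / 2 : ℝ) • (a₀ * a₀)) + Φ 2 * a₀ + V * (Φ 2 + z 1) -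
      (1 / 2 : ℝ) • (V * (V * (Φ 1 + z 0))) + (1 / 6 : ℝ) • (V * (V * (V * Φ 0))) := by
    rw [hz 0, hz 1, hz 2, ← h0] at h3
    linear_combination (norm := module) -h3
  have r3 : z 3 = Φ 0 * (a₃ + (1 / 2 : ℝ) • (a₀ * a₂ + a₁ * a₁ + a₂ * a₀) +
        (1 / 6 : ℝ) • (a₀ * a₀ * a₁ + a₀ * a₁ * a₀ + a₁ * a₀ * a₀) +
        (1 / 24 : ℝ) • (a₀ * a₀ * a₀ * a₀)) +
      Φ 1 * (a₂ + (1 / 2 : ℝ) • (a₀ * a₁ + a₁ * a₀) + (1 / 6 : ℝ) • (a₀ * a₀ * a₀)) +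
      Φ 2 * (a₁ + (1 / 2 : ℝ) • (a₀ * a₀)) + Φ 3 * a₀ + V * (Φ 3 + z 2) -
      (1 / 2 : ℝ) • (V * (V * (Φ 2 + z 1))) + (1 / 6 : ℝ) • (V * (V * (V * (Φ 1 + z 0)))) -
      (1 / 24 : ℝ) • (V * (V * (V * (V * Φ 0)))) := by
    rw [hz 0, hz 1, hz 2, hz 3, ← h0] at h4
    linear_combination (norm := module) -h4
  -- The relations r0 to r3 carry the bare Taylor coefficients. Substituting the lower ones into the
  -- higher ones recombines them into the symmetric form.
  refine ⟨r0, ?_, ?_, ?_⟩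
  · rw [r1, r0]
    simp only [Matrix.mul_add, Matrix.add_mul, Matrix.mul_smul, Matrix.smul_mul, Matrix.mul_assoc]
    module
  · rw [r2, r1, r0]
    simp only [Matrix.mul_add, Matrix.add_mul, Matrix.mul_sub, Matrix.sub_mul, Matrix.mul_smul,
      Matrix.smul_mul, Matrix.mul_assoc]
    module
  · rw [r3, r2, r1, r0]
    simp only [Matrix.mul_add, Matrix.add_mul, Matrix.mul_sub, Matrix.sub_mul, Matrix.mul_smul,
      Matrix.smul_mul, Matrix.mul_assoc]
    module

/-- The Chapman-Enskog relations: `z n` is the coefficient of `Δtⁿ⁺¹` in `m* - m`. -/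
theorem IsFormalExpansion.chapmanEnskog {L : LinearScheme d N r}
    {𝒜 : PowerSeries (Matrix (Fin N) (Fin N) (DiffOp d))}
    {β : ℕ → Matrix (Fin r) (Fin N) (DiffOp d)} (h : L.IsFormalExpansion 𝒜 β)
    (hM : IsUnit L.momentMatrix.det) (hs : ∀ l, L.relax l ≠ 0)
    (V : Matrix (Fin (N + r)) (Fin (N + r)) (DiffOp d)) (hV : V = L.advection)
    (Φ : Matrix (Fin (N + r)) (Fin N) (DiffOp d))
    (hΦ : Φ = fun k => Fin.addCases (fun i => (1 : Matrix _ _ (DiffOp d)) i)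
      (fun l i => C (L.E l i)) k)
    (S : Matrix (Fin (N + r)) (Fin (N + r)) (DiffOp d))
    (hS : S = Matrix.diagonal fun k => Fin.addCases (fun _ => 0)
      (fun l => C (1 / L.relax l - 1 / 2)) k)
    (a : ℕ → Matrix (Fin N) (Fin N) (DiffOp d)) (ha : ∀ n, a n = PowerSeries.coeff n 𝒜) :
    ∃ z : ℕ → Matrix (Fin (N + r)) (Fin N) (DiffOp d),
      (∀ n i, z n (Fin.castAdd r i) = 0) ∧
      z 0 = V * Φ + Φ * a 0 ∧
      z 1 = Φ * a 1 - V * (S * z 0) - (S * z 0) * a 0 ∧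
      z 2 = Φ * a 2 - V * (S * z 1) - (S * z 1) * a 0 - (S * z 0) * a 1 -
        (1 / 12 : ℝ) • (V * (V * z 0 + z 0 * a 0) + (V * z 0 + z 0 * a 0) * a 0) ∧
      z 3 = Φ * a 3 - V * (S * z 2) - (S * z 2) * a 0 - (S * z 1) * a 1 - (S * z 0) * a 2 -
        (1 / 12 : ℝ) • (V * (V * z 1 + z 1 * a 0) + (V * z 1 + z 1 * a 0) * a 0 +
          (V * (z 0 * a 1) + z 0 * a 1 * a 0) + (V * z 0 + z 0 * a 0) * a 1) := by
  set J : Matrix (Fin (N + r)) (Fin (N + r)) (DiffOp d) := L.collision.map C with hJ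
  set Ψ := momentSeries β with hΨ
  -- The index is shifted by one because the order zero part of m* - m vanishes: Ψ 0 is at
  -- equilibrium.
  let z : ℕ → Matrix (Fin (N + r)) (Fin N) (DiffOp d) := fun n => J * Ψ (n + 1) - Ψ (n + 1)
  have hz : ∀ n, J * Ψ (n + 1) = Ψ (n + 1) + z n := fun n => by simp [z]
  have htop : ∀ (B : Matrix (Fin (N + r)) (Fin N) (DiffOp d)) i,
      (J * B) (Fin.castAdd r i) = B (Fin.castAdd r i) := by
    intro B i
    ext1 j
    simp [Matrix.mul_apply, Fin.sum_univ_add, hJ, collision, Matrix.one_apply,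
      apply_ite (C (σ := Fin d))]
  have hbot : ∀ (B : Matrix (Fin (N + r)) (Fin N) (DiffOp d)) l j,
      (J * B) (Fin.natAdd N l) j = ∑ i, C (L.relax l * L.E l i) * B (Fin.castAdd r i) j +
        (1 - C (L.relax l)) * B (Fin.natAdd N l) j := by
    intro B l j
    simp [Matrix.mul_apply, Fin.sum_univ_add, hJ, collision, Matrix.one_apply,
      Matrix.diagonal_apply, apply_ite (C (σ := Fin d)), sub_mul]
  have hztop : ∀ n i, z n (Fin.castAdd r i) = 0 := by
    intro n i
    ext1 j
    simp only [z, Matrix.sub_apply, htop, sub_self, Pi.zero_apply]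
  have e : ∀ n, ∑ p ∈ Finset.HasAntidiagonal.antidiagonal n, Ψ p.1 * timeShift 𝒜 p.2 =
      ∑ p ∈ Finset.HasAntidiagonal.antidiagonal n,
        (1 / (p.1.factorial : ℝ)) • ((-V) ^ p.1 * (J * Ψ p.2)) := by
    intro n
    rw [h.sum_momentSeries n]
    refine Finset.sum_congr rfl fun p _ => ?_
    rw [L.derivation_eq hM, hV, Matrix.smul_mul, Matrix.mul_assoc]
  have h0 : Ψ 0 = J * Ψ 0 := by
    simpa [timeShift_zero] using e 0
  have hΨ0 : Ψ 0 = Φ := by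
    rw [hΦ]
    ext1 k j
    induction k using Fin.addCases with
    | left k => simp [hΨ, momentSeries]
    | right l =>
      have h1 := congrFun (congrFun h0 (Fin.natAdd N l)) j
      rw [hbot] at h1
      have h2 : ∑ i, C (L.relax l * L.E l i) * Ψ 0 (Fin.castAdd r i) j =
          (C (L.relax l * L.E l j) : DiffOp d) := by
        rw [Finset.sum_eq_single j]
        · simp [hΨ, momentSeries]
        · intro i _ hi
          simp [hΨ, momentSeries, hi]
        · simp
      rw [h2, C_mul] at h1
      have h3 : (C (L.relax l) : DiffOp d) ≠ 0 := by simpa using hs l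
      rw [Fin.addCases_right]
      apply mul_left_cancel₀ h3
      linear_combination h1
  -- On a slave row z n = -s Ψ (n + 1), hence Ψ (n + 1) + z n / 2 = -(1/s - 1/2) z n. On a conserved
  -- row both sides vanish since the order n + 1 is positive.
  have hσ : ∀ n, Ψ (n + 1) + (1 / 2 : ℝ) • z n = -(S * z n) := by
    intro n
    ext1 k j
    rw [hS]
    induction k using Fin.addCases with
    | left k =>
      rw [Matrix.add_apply, Matrix.smul_apply, Matrix.neg_apply, Matrix.diagonal_mul,
        Fin.addCases_left, hztop]
      simp [hΨ, momentSeries]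
    | right l =>
      have h2 : ∑ i, C (L.relax l * L.E l i) * Ψ (n + 1) (Fin.castAdd r i) j =
          (0 : DiffOp d) := Finset.sum_eq_zero fun i _ => by simp [hΨ, momentSeries]
      have h1 : z n (Fin.natAdd N l) j = -(C (L.relax l) * Ψ (n + 1) (Fin.natAdd N l) j) := by
        simp only [z, Matrix.sub_apply, hbot, h2]
        ring
      have h3 : (C (1 / L.relax l) : DiffOp d) * C (L.relax l) = 1 := by
        rw [← C_mul, one_div, inv_mul_cancel₀ (hs l), C_1]
      rw [Matrix.add_apply, Matrix.smul_apply, Matrix.neg_apply, Matrix.diagonal_mul,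
        Fin.addCases_right, smul_eq_C_mul, h1, C_sub]
      linear_combination (-Ψ (n + 1) (Fin.natAdd N l) j) * h3
  have key := exp_relations V J Ψ z (a 0) (a 1) (a 2) (a 3) hz h0
    (by
      have := e 1
      simp [Finset.Nat.antidiagonal_succ, timeShift_zero, timeShift_one, ← ha] at this
      rw [this]
      abel)
    (by
      have := e 2
      simp [Finset.Nat.antidiagonal_succ, timeShift_zero, timeShift_one, timeShift_two, ← ha,
        pow_succ, Matrix.mul_assoc] at this
      rw [← sub_eq_zero] at this ⊢
      rw [← this]
      simp only [Matrix.mul_add, Matrix.mul_smul]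
      module)
    (by
      have := e 3
      simp [Finset.Nat.antidiagonal_succ, timeShift_zero, timeShift_one, timeShift_two,
        timeShift_three, ← ha, pow_succ, Matrix.mul_assoc, Nat.factorial] at this
      rw [← sub_eq_zero] at this ⊢
      rw [← this]
      simp only [Matrix.mul_add, Matrix.mul_smul, Matrix.mul_assoc]
      module)
    (by
      have := e 4
      simp [Finset.Nat.antidiagonal_succ, timeShift_zero, timeShift_one, timeShift_two,
        timeShift_three, timeShift_four, ← ha, pow_succ, Matrix.mul_assoc, Nat.factorial] at this
      rw [← sub_eq_zero] at this ⊢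
      rw [← this]
      simp only [Matrix.mul_add, Matrix.mul_smul, Matrix.mul_assoc]
      module)
  simp only [hσ, hΨ0] at key
  obtain ⟨k0, k1, k2, k3⟩ := key
  refine ⟨z, hztop, k0, ?_, ?_, ?_⟩
  · rw [k1, Matrix.mul_neg, Matrix.neg_mul]
    abel
  · rw [k2]
    simp only [Matrix.mul_neg, Matrix.neg_mul]
    abel
  · rw [k3]
    simp only [Matrix.mul_neg, Matrix.neg_mul]
    abel

end LinearScheme

/-! ## The moments and the fluxes of D2Q13 -/

/-- The degrees of the moment polynomials of D2Q13. -/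
def d2q13Degree : Fin 13 → ℕ := ![0, 1, 1, 2, 2, 2, 3, 3, 5, 5, 4, 6, 4]

/-- The moment matrix of D2Q13 for `lam = 1`. -/
def d2q13IntMatrix : Matrix (Fin 13) (Fin 13) ℤ := Matrix.of
  ![![1, 1, 1, 1, 1, 1, 1, 1, 1, 1, 1, 1, 1],
  ![0, 1, 0, -1, 0, 1, -1, -1, 1, 2, 0, -2, 0],
  ![0, 0, 1, 0, -1, 1, 1, -1, -1, 0, 2, 0, -2],
  ![-28, -15, -15, -15, -15, -2, -2, -2, -2, 24, 24, 24, 24],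
  ![0, 1, -1, 1, -1, 0, 0, 0, 0, 4, -4, 4, -4],
  ![0, 0, 0, 0, 0, 1, -1, 1, -1, 0, 0, 0, 0],
  ![0, -2, 0, 2, 0, -1, 1, 1, -1, 2, 0, -2, 0],
  ![0, 0, -2, 0, 2, -1, -1, 1, 1, 0, 2, 0, -2],
  ![0, 4, 0, -4, 0, -3, 3, 3, -3, 1, 0, -1, 0],
  ![0, 0, 4, 0, -4, -3, -3, 3, 3, 0, 1, 0, -1],
  ![140, -2, -2, -2, -2, -67, -67, -67, -67, 34, 34, 34, 34],
  ![-12, 8, 8, 8, 8, -6, -6, -6, -6, 1, 1, 1, 1],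
  ![0, -4, 4, -4, 4, 0, 0, 0, 0, 1, -1, 1, -1]]

/-- The squared norms of the rows of `d2q13IntMatrix`. -/
def d2q13Norm : Fin 13 → ℤ := ![13, 14, 14, 4004, 68, 4, 20, 20, 70, 70, 42196, 548, 68]

/-- Orthogonality of the moments. It gives the inverse of the moment matrix without computing a
determinant. -/
theorem d2q13IntMatrix_mul_transpose (k l : Fin 13) :
    ∑ j, d2q13IntMatrix k j * d2q13IntMatrix l j = if k = l then d2q13Norm k else 0 := by
  revert k l
  decide +kernel

theorem d2q13Norm_ne_zero (k : Fin 13) : d2q13Norm k ≠ 0 := by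
  revert k
  decide

/-- The velocities of D2Q13 in units of `lam`. -/
def d2q13IntVelocity : Fin 13 → Fin 2 → ℤ :=
  ![![0, 0], ![1, 0], ![0, 1], ![-1, 0], ![0, -1], ![1, 1], ![-1, 1], ![-1, -1], ![1, -1],
    ![2, 0], ![0, 2], ![-2, 0], ![0, -2]]

theorem d2q13Velocity_apply (lam : ℝ) (j : Fin 13) (a : Fin 2) :
    d2q13Velocity lam j a = lam * d2q13IntVelocity j a := by
  fin_cases j <;> fin_cases a <;> simp [d2q13Velocity, d2q13IntVelocity]

/-- The moment polynomials of D2Q13 for `lam = 1`, times `24`. -/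
def d2q13IntPolynomial (x y : ℤ) : Fin 13 → ℤ :=
  ![24, 24 * x, 24 * y,
    312 * (x ^ 2 + y ^ 2) - 672,
    24 * (x ^ 2 - y ^ 2),
    24 * (x * y),
    24 * (x * (x ^ 2 + y ^ 2 - 3)),
    24 * (y * (x ^ 2 + y ^ 2 - 3)),
    x * (70 * (x ^ 2 + y ^ 2) ^ 2 - 378 * (x ^ 2 + y ^ 2) + 404),
    y * (70 * (x ^ 2 + y ^ 2) ^ 2 - 378 * (x ^ 2 + y ^ 2) + 404),
    924 * (x ^ 2 + y ^ 2) ^ 2 - 4332 * (x ^ 2 + y ^ 2) + 3360,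
    137 * (x ^ 2 + y ^ 2) ^ 3 - 819 * (x ^ 2 + y ^ 2) ^ 2 + 1162 * (x ^ 2 + y ^ 2) - 288,
    (x ^ 2 - y ^ 2) * (34 * (x ^ 2 + y ^ 2) - 130)]

theorem d2q13Polynomial_mul (lam : ℝ) (x y : ℤ) (k : Fin 13) :
    d2q13Polynomial lam (lam * x) (lam * y) k =
      lam ^ d2q13Degree k * ((d2q13IntPolynomial x y k : ℝ) / 24) := by
  fin_cases k <;> simp [d2q13Polynomial, d2q13Degree, d2q13IntPolynomial] <;> ring

/-- Clearing the denominators makes this a finite check on integers. -/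
theorem d2q13IntPolynomial_intVelocity (j k : Fin 13) :
    d2q13IntPolynomial (d2q13IntVelocity j 0) (d2q13IntVelocity j 1) k =
      24 * d2q13IntMatrix k j := by
  revert j k
  decide +kernel

theorem d2q13Matrix_apply (lam : ℝ) (k j : Fin 13) :
    d2q13Matrix lam k j = lam ^ d2q13Degree k * (d2q13IntMatrix k j : ℝ) := by
  rw [d2q13Matrix, d2q13Velocity_apply, d2q13Velocity_apply, d2q13Polynomial_mul,
    d2q13IntPolynomial_intVelocity]
  push_cast
  ring

/-- Each moment is homogeneous in `lam` and the velocities, so up to powers of `lam` the matrix is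
an integer matrix with orthogonal rows. A right inverse is its transpose, rescaled by the squared
norms. -/
theorem isUnit_det_d2q13Matrix {lam : ℝ} (hlam : lam ≠ 0) : IsUnit (d2q13Matrix lam).det := by
  refine Matrix.isUnit_det_of_right_inverse
    (B := Matrix.of fun j l => (d2q13IntMatrix l j : ℝ) / (d2q13Norm l * lam ^ d2q13Degree l)) ?_
  ext1 k l
  have h : ∀ j, d2q13Matrix lam k j *
      ((d2q13IntMatrix l j : ℝ) / (d2q13Norm l * lam ^ d2q13Degree l)) =
      lam ^ d2q13Degree k / (d2q13Norm l * lam ^ d2q13Degree l) *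
        ((d2q13IntMatrix k j * d2q13IntMatrix l j : ℤ) : ℝ) := by
    intro j
    rw [d2q13Matrix_apply]
    push_cast
    ring
  rw [Matrix.mul_apply]
  simp only [Matrix.of_apply, h]
  rw [← Finset.mul_sum, ← Int.cast_sum, d2q13IntMatrix_mul_transpose]
  have h1 : (d2q13Norm l : ℝ) ≠ 0 := Int.cast_ne_zero.2 (d2q13Norm_ne_zero l)
  split_ifs with hkl
  · subst hkl
    rw [Matrix.one_apply_eq]
    field_simp
  · rw [Matrix.one_apply_ne hkl, Int.cast_zero, mul_zero]

/-- The multiplication by `x v_x + y v_y` in the basis of the moments of D2Q13. -/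
noncomputable def d2q13Flux (lam x y : ℝ) : Matrix (Fin 13) (Fin 13) ℝ := Matrix.of
  ![![0, x, y, 0, 0, 0, 0, 0, 0, 0, 0, 0, 0],
    ![14 / 13 * lam ^ 2 * x, 0, 0, 1 / 26 * x, 1 / 2 * x, y, 0, 0, 0, 0, 0, 0, 0],
    ![14 / 13 * lam ^ 2 * y, 0, 0, 1 / 26 * y, -1 / 2 * y, x, 0, 0, 0, 0, 0, 0, 0],
    ![0, 11 * lam ^ 2 * x, 11 * lam ^ 2 * y, 0, 0, 0, 13 * x, 13 * y, 0, 0, 0, 0, 0],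
    ![0, 17 / 7 * lam ^ 2 * x, -17 / 7 * lam ^ 2 * y, 0, 0, 0, 7 / 5 * x, -7 / 5 * y,
      12 / 35 * (lam ^ 2)⁻¹ * x, -12 / 35 * (lam ^ 2)⁻¹ * y, 0, 0, 0],
    ![0, 2 / 7 * lam ^ 2 * y, 2 / 7 * lam ^ 2 * x, 0, 0, 0, -1 / 5 * y, -1 / 5 * x,
      -6 / 35 * (lam ^ 2)⁻¹ * y, -6 / 35 * (lam ^ 2)⁻¹ * x, 0, 0, 0],
    ![0, 0, 0, 5 / 77 * lam ^ 2 * x, 7 / 17 * lam ^ 2 * x, -lam ^ 2 * y, 0, 0, 0, 0,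
      1 / 77 * x, 0, 6 / 17 * x],
    ![0, 0, 0, 5 / 77 * lam ^ 2 * y, -7 / 17 * lam ^ 2 * y, -lam ^ 2 * x, 0, 0, 0, 0,
      1 / 77 * y, 0, -6 / 17 * y],
    ![0, 0, 0, 0, 6 / 17 * lam ^ 4 * x, -3 * lam ^ 4 * y, 0, 0, 0, 0,
      3 / 137 * lam ^ 2 * x, 35 / 137 * x, -7 / 17 * lam ^ 2 * x],
    ![0, 0, 0, 0, -6 / 17 * lam ^ 4 * y, -3 * lam ^ 4 * x, 0, 0, 0, 0,
      3 / 137 * lam ^ 2 * y, 35 / 137 * y, 7 / 17 * lam ^ 2 * y],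
    ![0, 0, 0, 0, 0, 0, 137 / 5 * lam ^ 2 * x, 137 / 5 * lam ^ 2 * y, 66 / 5 * x, 66 / 5 * y,
      0, 0, 0],
    ![0, 0, 0, 0, 0, 0, 0, 0, 2 * lam ^ 2 * x, 2 * lam ^ 2 * y, 0, 0, 0],
    ![0, 0, 0, 0, 0, 0, 6 / 5 * lam ^ 2 * x, -6 / 5 * lam ^ 2 * y, -2 / 5 * x, 2 / 5 * y,
      0, 0, 0]]

/-- Unrolls the sparse product once, so that later computations never meet a sum over thirteen
indices. -/
theorem d2q13Flux_mul_apply {n : Type*} (lam x y : ℝ) (Z : Matrix (Fin 13) n ℝ) (k : Fin 13)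
    (i : n) : (d2q13Flux lam x y * Z) k i =
    (![x * Z 1 i + y * Z 2 i,
      14 / 13 * lam ^ 2 * x * Z 0 i + 1 / 26 * x * Z 3 i + 1 / 2 * x * Z 4 i + y * Z 5 i,
      14 / 13 * lam ^ 2 * y * Z 0 i + 1 / 26 * y * Z 3 i - 1 / 2 * y * Z 4 i + x * Z 5 i,
      11 * lam ^ 2 * (x * Z 1 i + y * Z 2 i) + 13 * (x * Z 6 i + y * Z 7 i),
      17 / 7 * lam ^ 2 * (x * Z 1 i - y * Z 2 i) + 7 / 5 * (x * Z 6 i - y * Z 7 i) +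
        12 / 35 * (lam ^ 2)⁻¹ * (x * Z 8 i - y * Z 9 i),
      2 / 7 * lam ^ 2 * (y * Z 1 i + x * Z 2 i) - 1 / 5 * (y * Z 6 i + x * Z 7 i) -
        6 / 35 * (lam ^ 2)⁻¹ * (y * Z 8 i + x * Z 9 i),
      5 / 77 * lam ^ 2 * x * Z 3 i + 7 / 17 * lam ^ 2 * x * Z 4 i - lam ^ 2 * y * Z 5 i +
        1 / 77 * x * Z 10 i + 6 / 17 * x * Z 12 i,
      5 / 77 * lam ^ 2 * y * Z 3 i - 7 / 17 * lam ^ 2 * y * Z 4 i - lam ^ 2 * x * Z 5 i +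
        1 / 77 * y * Z 10 i - 6 / 17 * y * Z 12 i,
      6 / 17 * lam ^ 4 * x * Z 4 i - 3 * lam ^ 4 * y * Z 5 i + 3 / 137 * lam ^ 2 * x * Z 10 i +
        35 / 137 * x * Z 11 i - 7 / 17 * lam ^ 2 * x * Z 12 i,
      -6 / 17 * lam ^ 4 * y * Z 4 i - 3 * lam ^ 4 * x * Z 5 i + 3 / 137 * lam ^ 2 * y * Z 10 i +
        35 / 137 * y * Z 11 i + 7 / 17 * lam ^ 2 * y * Z 12 i,
      137 / 5 * lam ^ 2 * (x * Z 6 i + y * Z 7 i) + 66 / 5 * (x * Z 8 i + y * Z 9 i),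
      2 * lam ^ 2 * (x * Z 8 i + y * Z 9 i),
      6 / 5 * lam ^ 2 * (x * Z 6 i - y * Z 7 i) - 2 / 5 * (x * Z 8 i - y * Z 9 i)] :
      Fin 13 → ℝ) k := by
  rw [Matrix.mul_apply]
  fin_cases k <;> simp [d2q13Flux, Fin.sum_univ_succ] <;> ring

/-- The equations of the thirteen velocities. -/
theorem d2q13Velocity_equations (lam : ℝ) (j : Fin 13) {u v : ℝ} (hu : u = d2q13Velocity lam j 0)
    (hv : v = d2q13Velocity lam j 1) :
    u ^ 5 - 5 * lam ^ 2 * u ^ 3 + 4 * lam ^ 4 * u = 0 ∧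
    v ^ 5 - 5 * lam ^ 2 * v ^ 3 + 4 * lam ^ 4 * v = 0 ∧
    u ^ 3 * v - lam ^ 2 * (u * v) = 0 ∧ u * v ^ 3 - lam ^ 2 * (u * v) = 0 := by
  subst hu hv
  refine ⟨?_, ?_, ?_, ?_⟩ <;> fin_cases j <;> simp [d2q13Velocity] <;> ring

theorem d2q13Flux_mul_d2q13Matrix {lam : ℝ} (hlam : lam ≠ 0) (x y : ℝ) :
    d2q13Flux lam x y * d2q13Matrix lam = d2q13Matrix lam *
      Matrix.diagonal fun j => d2q13Velocity lam j 0 * x + d2q13Velocity lam j 1 * y := by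
  ext1 k j
  rw [d2q13Flux_mul_apply, Matrix.mul_diagonal]
  simp only [d2q13Matrix]
  generalize hu : d2q13Velocity lam j 0 = u
  generalize hv : d2q13Velocity lam j 1 = v
  -- These equations generate the ideal of the thirteen points, since exactly thirteen monomials
  -- avoid u⁵, v⁵, u³v and uv³. The rows that are not polynomial identities hold modulo this ideal,
  -- and the cofactors are written out below.
  obtain ⟨g1, g2, g3, g4⟩ := d2q13Velocity_equations lam j hu.symm hv.symm
  fin_cases k <;> simp [d2q13Polynomial]
  · ring
  · ring
  · ring
  · ring
  · field_simp
    linear_combination (29400 * x) * g1 + (-29400 * y) * g2 + (58800 * x * v - 29400 * y * u) * g3 +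
      (29400 * x * v - 58800 * y * u) * g4
  · field_simp
    linear_combination (-29400 * y) * g1 + (-29400 * x) * g2 + (-29400 * x * u - 58800 * y * v) * g3
      + (-58800 * x * u - 29400 * y * v) * g4
  · linear_combination (-y) * g3 + (-y) * g4
  · linear_combination (-x) * g3 + (-x) * g4
  · linear_combination (-35 / 24 * x * u - 35 / 12 * y * v) * g1 + (35 / 24 * x * v - 35 / 12 * y *
      u) * g2 + (-35 / 24 * x * u * v - 35 / 6 * y * v ^ 2 + 7 / 6 * y * lam ^ 2) * g3 + (35 /
      24 * x * u * v - 14 / 3 * y * lam ^ 2) * g4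
  · linear_combination (-35 / 12 * x * v + 35 / 24 * y * u) * g1 + (-35 / 12 * x * u - 35 / 24 * y *
      v) * g2 + (-35 / 6 * x * v ^ 2 + 7 / 6 * x * lam ^ 2 + 35 / 24 * y * u * v) * g3 + (-14 /
      3 * x * lam ^ 2 - 35 / 24 * y * u * v) * g4
  · ring
  · linear_combination (-137 / 24 * x * u ^ 2 - 137 / 8 * x * v ^ 2 + 137 / 12 * x * lam ^ 2 - 137 /
      24 * y * u * v) * g1 + (-137 / 24 * x * u * v - 137 / 8 * y * u ^ 2 - 137 / 24 * y * v ^ 2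
      + 137 / 12 * y * lam ^ 2) * g2 + (-137 / 8 * x * v ^ 3 - 137 / 24 * x * v * lam ^ 2 - 137
      / 8 * y * u * v ^ 2 + 137 / 12 * y * u * lam ^ 2) * g3 + (-137 / 24 * x * v * lam ^ 2 -
      137 / 6 * y * u * lam ^ 2) * g4
  · linear_combination (-31 / 12 * x) * g1 + (31 / 12 * y) * g2 + (-7 / 3 * x * v - 1 / 4 * y * u) *
      g3 + (1 / 4 * x * v + 7 / 3 * y * u) * g4

/-- The Chapman-Enskog relations of D2Q13 for the symbols at the point `(x, y)`. -/
theorem d2q13_relations {lam : ℝ} (hlam : lam ≠ 0) {s σ : Fin 13 → ℝ}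
    (hs : ∀ k, 3 ≤ k → s k ≠ 0) (hσ : ∀ k, 3 ≤ k → σ k = 1 / s k - 1 / 2)
    {G : Matrix (Fin 13) (Fin 3) ℝ} {𝒜 : PowerSeries (Matrix (Fin 3) (Fin 3) (DiffOp 2))}
    {β : ℕ → Matrix (Fin 10) (Fin 3) (DiffOp 2)} (h : (d2q13 lam s G).IsFormalExpansion 𝒜 β)
    (x y : ℝ) (W : Matrix (Fin 13) (Fin 13) ℝ) (hW : W = d2q13Flux lam x y)
    (Φ : Matrix (Fin 13) (Fin 3) ℝ)
    (hΦ : Φ = ![![1, 0, 0], ![0, 1, 0], ![0, 0, 1], G 3, G 4, G 5, G 6, G 7, G 8, G 9, G 10, G 11,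
      G 12])
    (S : Matrix (Fin 13) (Fin 13) ℝ) (hS : S = Matrix.diagonal σ)
    (a : ℕ → Matrix (Fin 3) (Fin 3) ℝ)
    (ha : ∀ n, a n = (PowerSeries.coeff n 𝒜).map (eval ![x, y])) :
    ∃ z : ℕ → Matrix (Fin 13) (Fin 3) ℝ,
      (∀ n, z n 0 = 0 ∧ z n 1 = 0 ∧ z n 2 = 0) ∧
      z 0 = W * Φ + Φ * a 0 ∧
      z 1 = Φ * a 1 - W * (S * z 0) - (S * z 0) * a 0 ∧
      z 2 = Φ * a 2 - W * (S * z 1) - (S * z 1) * a 0 - (S * z 0) * a 1 -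
        (1 / 12 : ℝ) • (W * (W * z 0 + z 0 * a 0) + (W * z 0 + z 0 * a 0) * a 0) ∧
      z 3 = Φ * a 3 - W * (S * z 2) - (S * z 2) * a 0 - (S * z 1) * a 1 - (S * z 0) * a 2 -
        (1 / 12 : ℝ) • (W * (W * z 1 + z 1 * a 0) + (W * z 1 + z 1 * a 0) * a 0 +
          (W * (z 0 * a 1) + z 0 * a 1 * a 0) + (W * z 0 + z 0 * a 0) * a 1) := by
  have hM := isUnit_det_d2q13Matrix hlam
  let Φ' : Matrix (Fin (3 + 10)) (Fin 3) (DiffOp 2) := fun k =>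
    Fin.addCases (fun i => (1 : Matrix _ _ (DiffOp 2)) i)
      (fun l i => C ((d2q13 lam s G).E l i)) k
  let S' : Matrix (Fin (3 + 10)) (Fin (3 + 10)) (DiffOp 2) := Matrix.diagonal fun k =>
    Fin.addCases (fun _ => 0) (fun l => C (1 / (d2q13 lam s G).relax l - 1 / 2)) k
  obtain ⟨z, hz, h0, h1, h2, h3⟩ := h.chapmanEnskog hM
    (fun l => hs _ (by simp [Fin.le_def])) _ rfl Φ' rfl S' rfl _ fun _ => rfl
  -- Evaluation of symbols at (x, y) is a ring homomorphism, so it carries the operator relations to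
  -- relations between real matrices.
  set e : DiffOp 2 →+* ℝ := eval ![x, y] with he
  have hV : (d2q13 lam s G).advection.map e = W := by
    have h1 : ((d2q13Matrix lam).map C).map e = d2q13Matrix lam := by
      ext1 i j
      simp [he]
    have h2 : (((d2q13Matrix lam)⁻¹).map C).map e = (d2q13Matrix lam)⁻¹ := by
      ext1 i j
      simp [he]
    have h3 : (Matrix.diagonal fun j => ∑ a, C (d2q13Velocity lam j a) * X a).map e =
        Matrix.diagonal fun j => d2q13Velocity lam j 0 * x + d2q13Velocity lam j 1 * y := by
      rw [Matrix.diagonal_map (map_zero e)]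
      simp [he, Fin.sum_univ_two]
    change (((d2q13Matrix lam).map C * (Matrix.diagonal fun j => ∑ a,
      C (d2q13Velocity lam j a) * X a) * (d2q13Matrix lam)⁻¹.map C).map e : Matrix _ _ ℝ) = W
    rw [Matrix.map_mul, Matrix.map_mul, h1, h2, h3, ← d2q13Flux_mul_d2q13Matrix hlam,
      Matrix.mul_assoc, Matrix.mul_nonsing_inv _ hM, Matrix.mul_one, hW]
  have hΦ' : Φ'.map e = Φ := by
    rw [hΦ]
    ext1 k i
    rw [Matrix.map_apply]
    fin_cases k <;> fin_cases i <;> first | exact map_one e | exact map_zero e | exact eval_C _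
  have hS' : ∀ n, (S' * z n).map e = S * (z n).map e := by
    intro n
    rw [hS]
    ext1 k i
    rw [Matrix.map_apply, Matrix.diagonal_mul]
    refine Eq.trans ?_ (Matrix.diagonal_mul σ _ k i).symm
    rw [Matrix.map_apply]
    induction k using Fin.addCases (m := 3) (n := 10) with
    -- The values of σ at the conserved indices do not matter, because these rows of z n vanish.
    | left k => simp [hz]
    | right l =>
      rw [Fin.addCases_right, hσ _ (by simp [Fin.le_def])]
      simp [he, d2q13]
  have ha' : ∀ n, (PowerSeries.coeff n 𝒜).map e = a n := fun n => (ha n).symm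
  have hsub : ∀ A B : Matrix (Fin (3 + 10)) (Fin 3) (DiffOp 2),
      (A - B).map e = A.map e - B.map e := Matrix.map_sub _ (map_sub e)
  have hadd : ∀ A B : Matrix (Fin (3 + 10)) (Fin 3) (DiffOp 2),
      (A + B).map e = A.map e + B.map e := Matrix.map_add _ (map_add e)
  have hsmul : ∀ A : Matrix (Fin (3 + 10)) (Fin 3) (DiffOp 2),
      ((1 / 12 : ℝ) • A).map e = (1 / 12 : ℝ) • A.map e :=
    fun A => Matrix.map_smul _ _ (fun b => by rw [he, smul_eval, smul_eq_mul]) A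
  have htop : ∀ n (i : Fin 3), (z n).map e (Fin.castAdd 10 i) = 0 := by
    intro n i
    ext1 j
    rw [Matrix.map_apply, hz]
    exact map_zero e
  refine ⟨fun n => (z n).map e, fun n => ⟨htop n 0, htop n 1, htop n 2⟩, ?_, ?_, ?_, ?_⟩
  · have := congrArg (·.map e) h0
    simpa only [hadd, Matrix.map_mul, hV, hΦ', ha'] using this
  · have := congrArg (·.map e) h1
    simpa only [hadd, hsub, Matrix.map_mul, hV, hΦ', hS', ha'] using this
  · have := congrArg (·.map e) h2
    simpa only [hadd, hsub, hsmul, Matrix.map_mul, hV, hΦ', hS', ha'] using this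
  · have := congrArg (·.map e) h3
    simpa only [hadd, hsub, hsmul, Matrix.map_mul, hV, hΦ', hS', ha'] using this

/-! ## The equivalent equations of D2Q13 at a point of the frequency space -/

/-- The equilibrium moments as functions of the conserved ones. -/
def d2q13Equilibrium (G : Matrix (Fin 13) (Fin 3) ℝ) : Matrix (Fin 13) (Fin 3) ℝ := Matrix.of
  ![![1, 0, 0], ![0, 1, 0], ![0, 0, 1], G 3, G 4, G 5, G 6, G 7, G 8, G 9, G 10, G 11, G 12]

theorem d2q13Equilibrium_conserved (G : Matrix (Fin 13) (Fin 3) ℝ) (i : Fin 3) :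
    d2q13Equilibrium G 0 i = (![1, 0, 0] : Fin 3 → ℝ) i ∧
    d2q13Equilibrium G 1 i = (![0, 1, 0] : Fin 3 → ℝ) i ∧
    d2q13Equilibrium G 2 i = (![0, 0, 1] : Fin 3 → ℝ) i :=
  ⟨rfl, rfl, rfl⟩

theorem SecondMomentsEquilibrium.apply {lam α : ℝ} {G : Matrix (Fin 13) (Fin 3) ℝ}
    (h : SecondMomentsEquilibrium lam α G) (i : Fin 3) :
    d2q13Equilibrium G 3 i = (![α * lam ^ 2, 0, 0] : Fin 3 → ℝ) i ∧
    d2q13Equilibrium G 4 i = 0 ∧ d2q13Equilibrium G 5 i = 0 :=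
  ⟨congrFun h.1 i, congrFun h.2.1 i, congrFun h.2.2 i⟩

theorem FluxEquilibrium.apply {lam φ κ : ℝ} {G : Matrix (Fin 13) (Fin 3) ℝ}
    (h : FluxEquilibrium lam φ κ G) (i : Fin 3) :
    d2q13Equilibrium G 6 i = (![0, φ * lam ^ 2, 0] : Fin 3 → ℝ) i ∧
    d2q13Equilibrium G 7 i = (![0, 0, φ * lam ^ 2] : Fin 3 → ℝ) i ∧
    d2q13Equilibrium G 8 i = (![0, κ * lam ^ 4, 0] : Fin 3 → ℝ) i ∧
    d2q13Equilibrium G 9 i = (![0, 0, κ * lam ^ 4] : Fin 3 → ℝ) i :=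
  ⟨congrFun h.1 i, congrFun h.2.1 i, congrFun h.2.2.1 i, congrFun h.2.2.2 i⟩

theorem ScalarEquilibrium.apply {lam e₂ e₃ : ℝ} {G : Matrix (Fin 13) (Fin 3) ℝ}
    (h : ScalarEquilibrium lam e₂ e₃ G) (i : Fin 3) :
    d2q13Equilibrium G 10 i = (![e₂ * lam ^ 4, 0, 0] : Fin 3 → ℝ) i ∧
    d2q13Equilibrium G 11 i = (![e₃ * lam ^ 6, 0, 0] : Fin 3 → ℝ) i ∧
    d2q13Equilibrium G 12 i = 0 :=
  ⟨congrFun h.1 i, congrFun h.2.1 i, congrFun h.2.2 i⟩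

/-- The Chapman-Enskog relations of D2Q13 at the point `(x, y)`: `a n` is the symbol of `α_{n+1}`
and `z n` the symbol of the coefficient of `Δtⁿ⁺¹` in `m* - m`. -/
structure D2Q13Relations (lam x y : ℝ) (σ : Fin 13 → ℝ) (G : Matrix (Fin 13) (Fin 3) ℝ)
    (a : ℕ → Matrix (Fin 3) (Fin 3) ℝ) (z : ℕ → Matrix (Fin 13) (Fin 3) ℝ) : Prop where
  lam_ne_zero : lam ≠ 0
  conserved : ∀ n i, z n 0 i = 0 ∧ z n 1 i = 0 ∧ z n 2 i = 0
  order1 : z 0 = d2q13Flux lam x y * d2q13Equilibrium G + d2q13Equilibrium G * a 0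
  order2 : z 1 = d2q13Equilibrium G * a 1 - d2q13Flux lam x y * (Matrix.diagonal σ * z 0) -
    (Matrix.diagonal σ * z 0) * a 0
  order3 : z 2 = d2q13Equilibrium G * a 2 - d2q13Flux lam x y * (Matrix.diagonal σ * z 1) -
    (Matrix.diagonal σ * z 1) * a 0 - (Matrix.diagonal σ * z 0) * a 1 -
    (1 / 12 : ℝ) • (d2q13Flux lam x y * (d2q13Flux lam x y * z 0 + z 0 * a 0) +
      (d2q13Flux lam x y * z 0 + z 0 * a 0) * a 0)
  order4 : z 3 = d2q13Equilibrium G * a 3 - d2q13Flux lam x y * (Matrix.diagonal σ * z 2) -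
    (Matrix.diagonal σ * z 2) * a 0 - (Matrix.diagonal σ * z 1) * a 1 -
    (Matrix.diagonal σ * z 0) * a 2 -
    (1 / 12 : ℝ) • (d2q13Flux lam x y * (d2q13Flux lam x y * z 1 + z 1 * a 0) +
      (d2q13Flux lam x y * z 1 + z 1 * a 0) * a 0 +
      (d2q13Flux lam x y * (z 0 * a 1) + z 0 * a 1 * a 0) +
      (d2q13Flux lam x y * z 0 + z 0 * a 0) * a 1)

theorem exists_d2q13Relations {lam : ℝ} (hlam : lam ≠ 0) {s σ : Fin 13 → ℝ}
    (hs : ∀ k, 3 ≤ k → s k ≠ 0) (hσ : ∀ k, 3 ≤ k → σ k = 1 / s k - 1 / 2)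
    {G : Matrix (Fin 13) (Fin 3) ℝ} {𝒜 : PowerSeries (Matrix (Fin 3) (Fin 3) (DiffOp 2))}
    {β : ℕ → Matrix (Fin 10) (Fin 3) (DiffOp 2)} (h : (d2q13 lam s G).IsFormalExpansion 𝒜 β)
    (x y : ℝ) : ∃ z, D2Q13Relations lam x y σ G
      (fun n => (PowerSeries.coeff n 𝒜).map (eval ![x, y])) z := by
  obtain ⟨z, hz, h0, h1, h2, h3⟩ := d2q13_relations hlam hs hσ h x y _ rfl _ rfl _ rfl
    (fun n => (PowerSeries.coeff n 𝒜).map (eval ![x, y])) fun _ => rfl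
  refine ⟨z, hlam, fun n i => ?_, h0, h1, h2, h3⟩
  rw [(hz n).1, (hz n).2.1, (hz n).2.2]
  exact ⟨rfl, rfl, rfl⟩

/-! ### The rows of the flux matrix -/

section FluxRows

variable {n : Type*} (lam x y : ℝ) (Z : Matrix (Fin 13) n ℝ) (i : n)

theorem d2q13Flux_mul_zero : (d2q13Flux lam x y * Z) 0 i = x * Z 1 i + y * Z 2 i := by
  rw [d2q13Flux_mul_apply]; rfl

theorem d2q13Flux_mul_one : (d2q13Flux lam x y * Z) 1 i =
    14 / 13 * lam ^ 2 * x * Z 0 i + 1 / 26 * x * Z 3 i + 1 / 2 * x * Z 4 i + y * Z 5 i := by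
  rw [d2q13Flux_mul_apply]; rfl

theorem d2q13Flux_mul_two : (d2q13Flux lam x y * Z) 2 i =
    14 / 13 * lam ^ 2 * y * Z 0 i + 1 / 26 * y * Z 3 i - 1 / 2 * y * Z 4 i + x * Z 5 i := by
  rw [d2q13Flux_mul_apply]; rfl

theorem d2q13Flux_mul_three : (d2q13Flux lam x y * Z) 3 i =
    11 * lam ^ 2 * (x * Z 1 i + y * Z 2 i) + 13 * (x * Z 6 i + y * Z 7 i) := by
  rw [d2q13Flux_mul_apply]; rfl

theorem d2q13Flux_mul_four : (d2q13Flux lam x y * Z) 4 i =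
    17 / 7 * lam ^ 2 * (x * Z 1 i - y * Z 2 i) + 7 / 5 * (x * Z 6 i - y * Z 7 i) +
      12 / 35 * (lam ^ 2)⁻¹ * (x * Z 8 i - y * Z 9 i) := by
  rw [d2q13Flux_mul_apply]; rfl

theorem d2q13Flux_mul_five : (d2q13Flux lam x y * Z) 5 i =
    2 / 7 * lam ^ 2 * (y * Z 1 i + x * Z 2 i) - 1 / 5 * (y * Z 6 i + x * Z 7 i) -
      6 / 35 * (lam ^ 2)⁻¹ * (y * Z 8 i + x * Z 9 i) := by
  rw [d2q13Flux_mul_apply]; rfl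

theorem d2q13Flux_mul_six : (d2q13Flux lam x y * Z) 6 i =
    5 / 77 * lam ^ 2 * x * Z 3 i + 7 / 17 * lam ^ 2 * x * Z 4 i - lam ^ 2 * y * Z 5 i +
      1 / 77 * x * Z 10 i + 6 / 17 * x * Z 12 i := by
  rw [d2q13Flux_mul_apply]; rfl

theorem d2q13Flux_mul_seven : (d2q13Flux lam x y * Z) 7 i =
    5 / 77 * lam ^ 2 * y * Z 3 i - 7 / 17 * lam ^ 2 * y * Z 4 i - lam ^ 2 * x * Z 5 i +
      1 / 77 * y * Z 10 i - 6 / 17 * y * Z 12 i := by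
  rw [d2q13Flux_mul_apply]; rfl

theorem d2q13Flux_mul_eight : (d2q13Flux lam x y * Z) 8 i =
    6 / 17 * lam ^ 4 * x * Z 4 i - 3 * lam ^ 4 * y * Z 5 i + 3 / 137 * lam ^ 2 * x * Z 10 i +
      35 / 137 * x * Z 11 i - 7 / 17 * lam ^ 2 * x * Z 12 i := by
  rw [d2q13Flux_mul_apply]; rfl

theorem d2q13Flux_mul_nine : (d2q13Flux lam x y * Z) 9 i =
    -6 / 17 * lam ^ 4 * y * Z 4 i - 3 * lam ^ 4 * x * Z 5 i + 3 / 137 * lam ^ 2 * y * Z 10 i +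
      35 / 137 * y * Z 11 i + 7 / 17 * lam ^ 2 * y * Z 12 i := by
  rw [d2q13Flux_mul_apply]; rfl

theorem d2q13Flux_mul_ten : (d2q13Flux lam x y * Z) 10 i =
    137 / 5 * lam ^ 2 * (x * Z 6 i + y * Z 7 i) + 66 / 5 * (x * Z 8 i + y * Z 9 i) := by
  rw [d2q13Flux_mul_apply]; rfl

theorem d2q13Flux_mul_eleven : (d2q13Flux lam x y * Z) 11 i =
    2 * lam ^ 2 * (x * Z 8 i + y * Z 9 i) := by
  rw [d2q13Flux_mul_apply]; rfl

theorem d2q13Flux_mul_twelve : (d2q13Flux lam x y * Z) 12 i =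
    6 / 5 * lam ^ 2 * (x * Z 6 i - y * Z 7 i) - 2 / 5 * (x * Z 8 i - y * Z 9 i) := by
  rw [d2q13Flux_mul_apply]; rfl

end FluxRows

theorem Matrix.mul_fin_three_apply {m : Type*} (Z : Matrix m (Fin 3) ℝ)
    (A : Matrix (Fin 3) (Fin 3) ℝ) (k : m) (i : Fin 3) :
    (Z * A) k i = Z k 0 * A 0 i + Z k 1 * A 1 i + Z k 2 * A 2 i := by
  rw [Matrix.mul_apply, Fin.sum_univ_three]

theorem forall_fin_three_apply_eq {f : Fin 3 → ℝ} {a b c : ℝ} (h0 : f 0 = a) (h1 : f 1 = b)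
    (h2 : f 2 = c) (i : Fin 3) : f i = (![a, b, c] : Fin 3 → ℝ) i := by
  subst h0 h1 h2
  fin_cases i <;> rfl

theorem mat3_ext {v : Matrix (Fin 3) (Fin 3) ℝ} {a b c d e f g h i : ℝ}
    (h00 : v 0 0 = a) (h01 : v 0 1 = b) (h02 : v 0 2 = c) (h10 : v 1 0 = d) (h11 : v 1 1 = e)
    (h12 : v 1 2 = f) (h20 : v 2 0 = g) (h21 : v 2 1 = h) (h22 : v 2 2 = i) :
    v = !![a, b, c; d, e, f; g, h, i] := by
  subst h00 h01 h02 h10 h11 h12 h20 h21 h22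
  ext i j
  fin_cases i <;> fin_cases j <;> rfl

namespace D2Q13Relations

variable {lam x y : ℝ} {σ : Fin 13 → ℝ} {G : Matrix (Fin 13) (Fin 3) ℝ}
  {a : ℕ → Matrix (Fin 3) (Fin 3) ℝ} {z : ℕ → Matrix (Fin 13) (Fin 3) ℝ}

theorem order1_apply (R : D2Q13Relations lam x y σ G a z) (k : Fin 13) (i : Fin 3) : z 0 k i =
    (d2q13Flux lam x y * d2q13Equilibrium G) k i + (d2q13Equilibrium G * a 0) k i :=
  congrFun (congrFun R.order1 k) i

/-- The symbol of `α₁`. -/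
theorem a_zero (R : D2Q13Relations lam x y σ G a z) {α : ℝ}
    (h2 : SecondMomentsEquilibrium lam α G) :
    a 0 = !![0, -x, -y; -(csq α * lam ^ 2 * x), 0, 0; -(csq α * lam ^ 2 * y), 0, 0] := by
  -- The conserved rows of z 0 vanish and those of the equilibrium matrix form the identity, so
  -- these rows of the relation give a 0 outright.
  have h : ∀ i, _ ∧ _ ∧ _ := fun i =>
    ⟨R.order1_apply 0 i, R.order1_apply 1 i, R.order1_apply 2 i⟩
  simp only [R.conserved, d2q13Flux_mul_zero, d2q13Flux_mul_one, d2q13Flux_mul_two,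
    Matrix.mul_fin_three_apply, d2q13Equilibrium_conserved, h2.apply] at h
  have h0 := h 0
  have h1 := h 1
  have h2 := h 2
  simp at h0 h1 h2
  unfold csq
  apply mat3_ext <;> linarith

/-- The second moments of the first order coefficient. -/
theorem z_zero_second (R : D2Q13Relations lam x y σ G a z) {α φ κ : ℝ}
    (h2 : SecondMomentsEquilibrium lam α G) (hf : FluxEquilibrium lam φ κ G) :
    (∀ i, z 0 3 i = (![0, (11 + 13 * φ - α) * lam ^ 2 * x, (11 + 13 * φ - α) * lam ^ 2 * y] :
      Fin 3 → ℝ) i) ∧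
    (∀ i, z 0 4 i = (![0, (17 / 7 + 7 / 5 * φ + 12 / 35 * κ) * lam ^ 2 * x,
      -((17 / 7 + 7 / 5 * φ + 12 / 35 * κ) * lam ^ 2 * y)] : Fin 3 → ℝ) i) ∧
    (∀ i, z 0 5 i = (![0, (2 / 7 - 1 / 5 * φ - 6 / 35 * κ) * lam ^ 2 * y,
      (2 / 7 - 1 / 5 * φ - 6 / 35 * κ) * lam ^ 2 * x] : Fin 3 → ℝ) i) := by
  have hl := R.lam_ne_zero
  refine ⟨forall_fin_three_apply_eq ?_ ?_ ?_, forall_fin_three_apply_eq ?_ ?_ ?_,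
    forall_fin_three_apply_eq ?_ ?_ ?_⟩ <;> rw [R.order1_apply] <;>
  simp [d2q13Flux_mul_three, d2q13Flux_mul_four, d2q13Flux_mul_five,
    Matrix.mul_fin_three_apply, d2q13Equilibrium_conserved, h2.apply, hf.apply, R.a_zero h2] <;>
  field_simp <;> ring

theorem order2_apply (R : D2Q13Relations lam x y σ G a z) (k : Fin 13) (i : Fin 3) : z 1 k i =
    (d2q13Equilibrium G * a 1) k i - (d2q13Flux lam x y * (Matrix.diagonal σ * z 0)) k i -
      (Matrix.diagonal σ * z 0 * a 0) k i :=
  congrFun (congrFun R.order2 k) i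

theorem order3_apply (R : D2Q13Relations lam x y σ G a z) (k : Fin 13) (i : Fin 3) : z 2 k i =
    (d2q13Equilibrium G * a 2) k i - (d2q13Flux lam x y * (Matrix.diagonal σ * z 1)) k i -
      (Matrix.diagonal σ * z 1 * a 0) k i - (Matrix.diagonal σ * z 0 * a 1) k i -
      1 / 12 * ((d2q13Flux lam x y * (d2q13Flux lam x y * z 0 + z 0 * a 0)) k i +
        ((d2q13Flux lam x y * z 0 + z 0 * a 0) * a 0) k i) :=
  congrFun (congrFun R.order3 k) i

theorem order4_apply (R : D2Q13Relations lam x y σ G a z) (k : Fin 13) (i : Fin 3) : z 3 k i =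
    (d2q13Equilibrium G * a 3) k i - (d2q13Flux lam x y * (Matrix.diagonal σ * z 2)) k i -
      (Matrix.diagonal σ * z 2 * a 0) k i - (Matrix.diagonal σ * z 1 * a 1) k i -
      (Matrix.diagonal σ * z 0 * a 2) k i -
      1 / 12 * ((d2q13Flux lam x y * (d2q13Flux lam x y * z 1 + z 1 * a 0)) k i +
        ((d2q13Flux lam x y * z 1 + z 1 * a 0) * a 0) k i +
        ((d2q13Flux lam x y * (z 0 * a 1)) k i + (z 0 * a 1 * a 0) k i) +
        ((d2q13Flux lam x y * z 0 + z 0 * a 0) * a 1) k i) :=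
  congrFun (congrFun R.order4 k) i

/-- A conserved row of the fourth order relation, solved for `a 3`. -/
theorem a_three_apply (R : D2Q13Relations lam x y σ G a z) {k : Fin 13} {l i : Fin 3}
    (hz : z 3 k i = 0) (hk : (d2q13Equilibrium G * a 3) k i = a 3 l i) : a 3 l i =
    (d2q13Flux lam x y * (Matrix.diagonal σ * z 2)) k i +
      (Matrix.diagonal σ * z 2 * a 0) k i + (Matrix.diagonal σ * z 1 * a 1) k i +
      (Matrix.diagonal σ * z 0 * a 2) k i +
      1 / 12 * ((d2q13Flux lam x y * (d2q13Flux lam x y * z 1 + z 1 * a 0)) k i +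
        ((d2q13Flux lam x y * z 1 + z 1 * a 0) * a 0) k i +
        ((d2q13Flux lam x y * (z 0 * a 1)) k i + (z 0 * a 1 * a 0) k i) +
        ((d2q13Flux lam x y * z 0 + z 0 * a 0) * a 1) k i) := by
  have h := R.order4_apply k i
  rw [hz, hk] at h
  linarith

/-- The symbol of `α₂`. -/
theorem a_one (R : D2Q13Relations lam x y σ G a z) {A B K : ℝ}
    (h3 : ∀ i, z 0 3 i = (![0, A * lam ^ 2 * x, A * lam ^ 2 * y] : Fin 3 → ℝ) i)
    (h4 : ∀ i, z 0 4 i = (![0, B * lam ^ 2 * x, -(B * lam ^ 2 * y)] : Fin 3 → ℝ) i)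
    (h5 : ∀ i, z 0 5 i = (![0, K * lam ^ 2 * y, K * lam ^ 2 * x] : Fin 3 → ℝ) i) :
    a 1 = !![0, 0, 0;
      0, lam ^ 2 * ((σ 3 * A / 26 + σ 4 * B / 2) * x ^ 2 + σ 5 * K * y ^ 2),
        lam ^ 2 * ((σ 3 * A / 26 - σ 4 * B / 2 + σ 5 * K) * (x * y));
      0, lam ^ 2 * ((σ 3 * A / 26 - σ 4 * B / 2 + σ 5 * K) * (x * y)),
        lam ^ 2 * ((σ 3 * A / 26 + σ 4 * B / 2) * y ^ 2 + σ 5 * K * x ^ 2)] := by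
  have h : ∀ i, _ ∧ _ ∧ _ := fun i =>
    ⟨R.order2_apply 0 i, R.order2_apply 1 i, R.order2_apply 2 i⟩
  simp only [R.conserved, d2q13Flux_mul_zero, d2q13Flux_mul_one, d2q13Flux_mul_two,
    Matrix.mul_fin_three_apply, d2q13Equilibrium_conserved, Matrix.diagonal_mul, h3, h4, h5] at h
  have h0 := h 0
  have h1 := h 1
  have h2 := h 2
  simp at h0 h1 h2
  apply mat3_ext <;> linarith

/-- The first row of the symbol of `α₃`. -/
theorem a_two_mass (R : D2Q13Relations lam x y σ G a z) {A K : ℝ}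
    (h3 : ∀ i, z 0 3 i = (![0, A * lam ^ 2 * x, A * lam ^ 2 * y] : Fin 3 → ℝ) i)
    (h4 : ∀ i, z 0 4 i = (![0, 2 * K * lam ^ 2 * x, -(2 * K * lam ^ 2 * y)] : Fin 3 → ℝ) i)
    (h5 : ∀ i, z 0 5 i = (![0, K * lam ^ 2 * y, K * lam ^ 2 * x] : Fin 3 → ℝ) i) :
    a 2 0 0 = 0 ∧ a 2 0 1 = (A / 26 + K) / 12 * lam ^ 2 * ((x ^ 2 + y ^ 2) * x) ∧
      a 2 0 2 = (A / 26 + K) / 12 * lam ^ 2 * ((x ^ 2 + y ^ 2) * y) := by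
  have h := fun i => R.order3_apply 0 i
  simp only [R.conserved, d2q13Flux_mul_zero, d2q13Flux_mul_one, d2q13Flux_mul_two,
    Matrix.mul_fin_three_apply, d2q13Equilibrium_conserved, Matrix.diagonal_mul, Matrix.add_apply,
    h3, h4, h5] at h
  have h0 := h 0
  have h1 := h 1
  have h2 := h 2
  simp at h0 h1 h2
  refine ⟨?_, ?_, ?_⟩ <;> linarith

/-- The coefficients B of XX and K of XY satisfy B + 2K = 3 + φ whatever r^eq is. The value
`rCoeff3` is the one for which B = 2K. -/
theorem z_zero_third (R : D2Q13Relations lam x y σ G a z) {α φ : ℝ}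
    (h2 : SecondMomentsEquilibrium lam α G) (hf : FluxEquilibrium lam φ (rCoeff3 φ) G) :
    (∀ i, z 0 3 i = (![0, (11 + 13 * φ - α) * lam ^ 2 * x, (11 + 13 * φ - α) * lam ^ 2 * y] :
      Fin 3 → ℝ) i) ∧
    (∀ i, z 0 4 i = (![0, 2 * ((3 + φ) / 4) * lam ^ 2 * x, -(2 * ((3 + φ) / 4) * lam ^ 2 * y)] :
      Fin 3 → ℝ) i) ∧
    (∀ i, z 0 5 i = (![0, (3 + φ) / 4 * lam ^ 2 * y, (3 + φ) / 4 * lam ^ 2 * x] :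
      Fin 3 → ℝ) i) := by
  obtain ⟨h3, h4, h5⟩ := R.z_zero_second h2 hf
  have e4 : 17 / 7 + 7 / 5 * φ + 12 / 35 * rCoeff3 φ = 2 * ((3 + φ) / 4) := by
    unfold rCoeff3
    ring
  have e5 : 2 / 7 - 1 / 5 * φ - 6 / 35 * rCoeff3 φ = (3 + φ) / 4 := by
    unfold rCoeff3
    ring
  rw [e4] at h4
  rw [e5] at h5
  exact ⟨h3, h4, h5⟩

/-- This is where the prescribed ε₂^eq and ε₃^eq come from. With XX_e^eq = 0, the rows of q vanish
when e₂ = 77 φ c_s² - 5 α, and those of r when 3 e₂ + 35 e₃ = 137 c_s² `rCoeff3 φ`. -/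
theorem z_zero_flux (R : D2Q13Relations lam x y σ G a z) {α φ : ℝ}
    (h2 : SecondMomentsEquilibrium lam α G) (hf : FluxEquilibrium lam φ (rCoeff3 φ) G)
    (hs : ScalarEquilibrium lam (eps2Coeff α φ) (eps3Coeff α φ) G) (i : Fin 3) :
    z 0 6 i = 0 ∧ z 0 7 i = 0 ∧ z 0 8 i = 0 ∧ z 0 9 i = 0 := by
  refine ⟨?_, ?_, ?_, ?_⟩ <;> rw [R.order1_apply] <;> revert i <;>
  simp [Fin.forall_fin_succ, d2q13Flux_mul_six, d2q13Flux_mul_seven, d2q13Flux_mul_eight,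
    d2q13Flux_mul_nine, Matrix.mul_fin_three_apply, h2.apply, hf.apply,
    hs.apply, R.a_zero h2, rCoeff3, eps2Coeff, eps3Coeff, csq] <;>
  ring

theorem z_zero_scalar (R : D2Q13Relations lam x y σ G a z) {α φ B₁ B₂ B₃ : ℝ}
    (h2 : SecondMomentsEquilibrium lam α G) (hf : FluxEquilibrium lam φ (rCoeff3 φ) G)
    (hs : ScalarEquilibrium lam (eps2Coeff α φ) (eps3Coeff α φ) G)
    (h₁ : B₁ = -(143 / 4) + 5 * α - 77 / 26 * α * φ - 4689 / 52 * φ)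
    (h₂ : B₂ = 6 - 1 / 48 * α + 135 / 208 * α * φ + 168 / 13 * φ)
    (h₃ : B₃ = 13 / 12 + 9 / 4 * φ) :
    (∀ i, z 0 10 i = (![0, B₁ * lam ^ 4 * x, B₁ * lam ^ 4 * y] : Fin 3 → ℝ) i) ∧
    (∀ i, z 0 11 i = (![0, B₂ * lam ^ 6 * x, B₂ * lam ^ 6 * y] : Fin 3 → ℝ) i) ∧
    (∀ i, z 0 12 i = (![0, B₃ * lam ^ 4 * x, -(B₃ * lam ^ 4 * y)] : Fin 3 → ℝ) i) := by
  subst h₁ h₂ h₃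
  refine ⟨forall_fin_three_apply_eq ?_ ?_ ?_, forall_fin_three_apply_eq ?_ ?_ ?_,
    forall_fin_three_apply_eq ?_ ?_ ?_⟩ <;> rw [R.order1_apply] <;>
  simp [d2q13Flux_mul_ten, d2q13Flux_mul_eleven, d2q13Flux_mul_twelve,
    Matrix.mul_fin_three_apply, hf.apply, hs.apply,
    R.a_zero h2, rCoeff3, eps2Coeff, eps3Coeff] <;>
  ring

end D2Q13Relations

/-! ### Coefficients of orders three and four in the isotropic case -/

/-- The Chapman-Enskog relations of D2Q13 under the conditions that make the second order isotropic
and the first order fluxes of `q` and `r` vanish. -/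
structure D2Q13IsotropicRelations (lam x y α φ κ c A K ν τ B₁ B₂ B₃ : ℝ) (σ : Fin 13 → ℝ)
    (G : Matrix (Fin 13) (Fin 3) ℝ) (a : ℕ → Matrix (Fin 3) (Fin 3) ℝ)
    (z : ℕ → Matrix (Fin 13) (Fin 3) ℝ) : Prop extends D2Q13Relations lam x y σ G a z where
  sigma5 : σ 5 = σ 4
  secondMoments : SecondMomentsEquilibrium lam α G
  fluxes : FluxEquilibrium lam φ κ G
  a0 : a 0 = !![0, -x, -y; -(c * lam ^ 2 * x), 0, 0; -(c * lam ^ 2 * y), 0, 0]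
  a1 : a 1 = !![0, 0, 0;
    0, lam ^ 2 * (ν * (x ^ 2 + y ^ 2) + τ * x ^ 2), lam ^ 2 * (τ * (x * y));
    0, lam ^ 2 * (τ * (x * y)), lam ^ 2 * (ν * (x ^ 2 + y ^ 2) + τ * y ^ 2)]
  z3 : ∀ i, z 0 3 i = (![0, A * lam ^ 2 * x, A * lam ^ 2 * y] : Fin 3 → ℝ) i
  z4 : ∀ i, z 0 4 i = (![0, 2 * K * lam ^ 2 * x, -(2 * K * lam ^ 2 * y)] : Fin 3 → ℝ) i
  z5 : ∀ i, z 0 5 i = (![0, K * lam ^ 2 * y, K * lam ^ 2 * x] : Fin 3 → ℝ) i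
  zflux : ∀ i, z 0 6 i = 0 ∧ z 0 7 i = 0 ∧ z 0 8 i = 0 ∧ z 0 9 i = 0
  z10 : ∀ i, z 0 10 i = (![0, B₁ * lam ^ 4 * x, B₁ * lam ^ 4 * y] : Fin 3 → ℝ) i
  z11 : ∀ i, z 0 11 i = (![0, B₂ * lam ^ 6 * x, B₂ * lam ^ 6 * y] : Fin 3 → ℝ) i
  z12 : ∀ i, z 0 12 i = (![0, B₃ * lam ^ 4 * x, -(B₃ * lam ^ 4 * y)] : Fin 3 → ℝ) i

namespace D2Q13IsotropicRelations

variable {lam x y α φ κ c A K ν τ B₁ B₂ B₃ : ℝ} {σ : Fin 13 → ℝ}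
  {G : Matrix (Fin 13) (Fin 3) ℝ} {a : ℕ → Matrix (Fin 3) (Fin 3) ℝ}
  {z : ℕ → Matrix (Fin 13) (Fin 3) ℝ}

/-- As the first order fluxes of q and r vanish, advection contributes nothing to these rows. Only
the term -σ z 0 a 0 remains, which acts on ρ alone. -/
theorem z_one_second (R : D2Q13IsotropicRelations lam x y α φ κ c A K ν τ B₁ B₂ B₃ σ G a z) :
    (∀ i, z 1 3 i = (![σ 3 * A * c * lam ^ 4 * (x ^ 2 + y ^ 2), 0, 0] : Fin 3 → ℝ) i) ∧
    (∀ i, z 1 4 i = (![2 * σ 4 * K * c * lam ^ 4 * (x ^ 2 - y ^ 2), 0, 0] : Fin 3 → ℝ) i) ∧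
    (∀ i, z 1 5 i = (![2 * σ 4 * K * c * lam ^ 4 * (x * y), 0, 0] : Fin 3 → ℝ) i) := by
  refine ⟨forall_fin_three_apply_eq ?_ ?_ ?_, forall_fin_three_apply_eq ?_ ?_ ?_,
    forall_fin_three_apply_eq ?_ ?_ ?_⟩ <;> rw [R.order2_apply] <;>
  simp [d2q13Flux_mul_three, d2q13Flux_mul_four, d2q13Flux_mul_five, R.conserved,
    Matrix.mul_fin_three_apply, R.secondMoments.apply, R.sigma5, R.a0, R.a1,
    R.z3, R.z4, R.z5, R.zflux] <;>
  ring

/-- The symbol of `α₃`. -/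
theorem a_two (R : D2Q13IsotropicRelations lam x y α φ κ c A K ν τ B₁ B₂ B₃ σ G a z) {ξ χ : ℝ}
    (hξ : ξ = (A / 26 + K) / 12)
    (hχ : χ = c * (σ 3 ^ 2 * A / 26 + σ 4 ^ 2 * K - (A / 26 + K) / 6)) :
    a 2 = !![0, ξ * lam ^ 2 * ((x ^ 2 + y ^ 2) * x), ξ * lam ^ 2 * ((x ^ 2 + y ^ 2) * y);
      χ * lam ^ 4 * ((x ^ 2 + y ^ 2) * x), 0, 0;
      χ * lam ^ 4 * ((x ^ 2 + y ^ 2) * y), 0, 0] := by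
  subst hξ hχ
  obtain ⟨h3, h4, h5⟩ := R.z_one_second
  obtain ⟨m0, m1, m2⟩ := R.a_two_mass R.z3 R.z4 R.z5
  have h : ∀ i, _ ∧ _ := fun i => ⟨R.order3_apply 1 i, R.order3_apply 2 i⟩
  simp only [R.conserved, d2q13Flux_mul_zero, d2q13Flux_mul_one, d2q13Flux_mul_two,
    d2q13Flux_mul_three, d2q13Flux_mul_four, d2q13Flux_mul_five,
    Matrix.mul_fin_three_apply, d2q13Equilibrium_conserved, Matrix.diagonal_mul, Matrix.add_apply,
    R.z3, R.z4, R.z5, R.zflux, h3, h4, h5, R.a0, R.sigma5] at h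
  have h0 := h 0
  have h1 := h 1
  have h2 := h 2
  simp at h0 h1 h2
  apply mat3_ext <;> linarith

/-- The parameters σ₁₀ and σ₁₁ enter here. Square symmetry leaves three coefficients for q and three
for r. They are kept as letters bound by equations, so that later orders manipulate short
polynomials. -/
theorem z_one_flux (R : D2Q13IsotropicRelations lam x y α φ κ c A K ν τ B₁ B₂ B₃ σ G a z)
    {p q r p' q' r' : ℝ} (s12 : σ 12 = σ 11)
    (hp : p = φ * ν + φ * τ - 5 / 77 * A * σ 3 - 14 / 17 * K * σ 4 - 1 / 77 * B₁ * σ 10 -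
      6 / 17 * B₃ * σ 11)
    (hq : q = φ * ν + K * σ 4)
    (hr : r = φ * τ - 5 / 77 * A * σ 3 + 31 / 17 * K * σ 4 - 1 / 77 * B₁ * σ 10 +
      6 / 17 * B₃ * σ 11)
    (hp' : p' = -(12 / 17) * K * σ 4 - 3 / 137 * B₁ * σ 10 - 35 / 137 * B₂ * σ 11 +
      7 / 17 * B₃ * σ 11 + ν * κ + τ * κ)
    (hq' : q' = 3 * K * σ 4 + ν * κ)
    (hr' : r' = 63 / 17 * K * σ 4 - 3 / 137 * B₁ * σ 10 - 35 / 137 * B₂ * σ 11 -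
      7 / 17 * B₃ * σ 11 + τ * κ) :
    (∀ i, z 1 6 i = (![0, lam ^ 4 * (p * x ^ 2 + q * y ^ 2), lam ^ 4 * (r * (x * y))] :
      Fin 3 → ℝ) i) ∧
    (∀ i, z 1 7 i = (![0, lam ^ 4 * (r * (x * y)), lam ^ 4 * (p * y ^ 2 + q * x ^ 2)] :
      Fin 3 → ℝ) i) ∧
    (∀ i, z 1 8 i = (![0, lam ^ 6 * (p' * x ^ 2 + q' * y ^ 2), lam ^ 6 * (r' * (x * y))] :
      Fin 3 → ℝ) i) ∧
    (∀ i, z 1 9 i = (![0, lam ^ 6 * (r' * (x * y)), lam ^ 6 * (p' * y ^ 2 + q' * x ^ 2)] :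
      Fin 3 → ℝ) i) := by
  subst hp hq hr hp' hq' hr'
  refine ⟨forall_fin_three_apply_eq ?_ ?_ ?_, forall_fin_three_apply_eq ?_ ?_ ?_,
    forall_fin_three_apply_eq ?_ ?_ ?_, forall_fin_three_apply_eq ?_ ?_ ?_⟩ <;>
  rw [R.order2_apply] <;>
  simp [d2q13Flux_mul_six, d2q13Flux_mul_seven, d2q13Flux_mul_eight, d2q13Flux_mul_nine,
    Matrix.mul_fin_three_apply, R.fluxes.apply, R.sigma5, s12, R.a0, R.a1,
    R.z3, R.z4, R.z5, R.zflux, R.z10, R.z11, R.z12] <;>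
  ring

/-- The parameters σ₆ and σ₈ enter here, acting on the fluxes of z 1. The terms in B₁, B₂, B₃ free
of relaxation parameters come from the 1/12 correction, which applies advection twice to z 0. -/
theorem z_two_second (R : D2Q13IsotropicRelations lam x y α φ κ c A K ν τ B₁ B₂ B₃ σ G a z)
    {p q r p' q' r' ξ χ u₁ u₂ v₁ v₂ w₁ w₂ : ℝ} (s7 : σ 7 = σ 6) (s9 : σ 9 = σ 8)
    (ha2 : a 2 = !![0, ξ * lam ^ 2 * ((x ^ 2 + y ^ 2) * x), ξ * lam ^ 2 * ((x ^ 2 + y ^ 2) * y);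
      χ * lam ^ 4 * ((x ^ 2 + y ^ 2) * x), 0, 0; χ * lam ^ 4 * ((x ^ 2 + y ^ 2) * y), 0, 0])
    (h6 : ∀ i, z 1 6 i = (![0, lam ^ 4 * (p * x ^ 2 + q * y ^ 2), lam ^ 4 * (r * (x * y))] :
      Fin 3 → ℝ) i)
    (h7 : ∀ i, z 1 7 i = (![0, lam ^ 4 * (r * (x * y)), lam ^ 4 * (p * y ^ 2 + q * x ^ 2)] :
      Fin 3 → ℝ) i)
    (h8 : ∀ i, z 1 8 i = (![0, lam ^ 6 * (p' * x ^ 2 + q' * y ^ 2), lam ^ 6 * (r' * (x * y))] :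
      Fin 3 → ℝ) i)
    (h9 : ∀ i, z 1 9 i = (![0, lam ^ 6 * (r' * (x * y)), lam ^ 6 * (p' * y ^ 2 + q' * x ^ 2)] :
      Fin 3 → ℝ) i)
    (hu₁ : u₁ = α * ξ - 1 / 12 * c * A + c * A * σ 3 ^ 2 - 2537 / 24024 * A - A * ν * σ 3 -
      A * τ * σ 3 - 123 / 68 * K - 13 / 924 * B₁ - 13 / 34 * B₃ - 13 * p * σ 6)
    (hu₂ : u₂ = α * ξ - 1 / 12 * c * A + c * A * σ 3 ^ 2 - 2537 / 24024 * A - A * ν * σ 3 -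
      A * τ * σ 3 + 437 / 204 * K - 13 / 924 * B₁ + 13 / 34 * B₃ - 13 * q * σ 6 - 13 * r * σ 6)
    (hv₁ : v₁ = -(1 / 6) * c * K + 2 * c * K * σ 4 ^ 2 - 123 / 8008 * A - 65 / 204 * K -
      2 * K * ν * σ 4 - 2 * K * τ * σ 4 - 271 / 126588 * B₁ - 1 / 137 * B₂ - 1 / 34 * B₃ -
      7 / 5 * p * σ 6 - 12 / 35 * p' * σ 8)
    (hv₂ : v₂ = 1 / 6 * c * K - 2 * c * K * σ 4 ^ 2 + 123 / 8008 * A - 65 / 204 * K -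
      2 * K * ν * σ 4 + 2 * K * τ * σ 4 + 271 / 126588 * B₁ + 1 / 137 * B₂ - 1 / 34 * B₃ -
      7 / 5 * q * σ 6 + 7 / 5 * r * σ 6 - 12 / 35 * q' * σ 8 + 12 / 35 * r' * σ 8)
    (hw₁ : w₁ = -(1 / 6) * c * K + 2 * c * K * σ 4 ^ 2 + 1 / 3003 * A - 1 / 12 * K - K * ν * σ 4 -
      2 * K * τ * σ 4 + 67 / 63294 * B₁ + 1 / 137 * B₂ + 1 / 5 * p * σ 6 + 1 / 5 * r * σ 6 +
      6 / 35 * p' * σ 8 + 6 / 35 * r' * σ 8)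
    (hw₂ : w₂ = -(1 / 12) * K - K * ν * σ 4 + 1 / 5 * q * σ 6 + 6 / 35 * q' * σ 8) :
    (∀ i, z 2 3 i = (![0, lam ^ 4 * (u₁ * x ^ 3 + u₂ * (x * y ^ 2)),
      lam ^ 4 * (u₁ * y ^ 3 + u₂ * (x ^ 2 * y))] : Fin 3 → ℝ) i) ∧
    (∀ i, z 2 4 i = (![0, lam ^ 4 * (v₁ * x ^ 3 + v₂ * (x * y ^ 2)),
      -(lam ^ 4 * (v₁ * y ^ 3 + v₂ * (x ^ 2 * y)))] : Fin 3 → ℝ) i) ∧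
    (∀ i, z 2 5 i = (![0, lam ^ 4 * (w₁ * (x ^ 2 * y) + w₂ * y ^ 3),
      lam ^ 4 * (w₁ * (x * y ^ 2) + w₂ * x ^ 3)] : Fin 3 → ℝ) i) := by
  subst hu₁ hu₂ hv₁ hv₂ hw₁ hw₂
  obtain ⟨h3, h4, h5⟩ := R.z_one_second
  have hl := R.lam_ne_zero
  refine ⟨forall_fin_three_apply_eq ?_ ?_ ?_, forall_fin_three_apply_eq ?_ ?_ ?_,
    forall_fin_three_apply_eq ?_ ?_ ?_⟩ <;>
  rw [R.order3_apply] <;>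
  simp [d2q13Flux_mul_one, d2q13Flux_mul_two, d2q13Flux_mul_three,
    d2q13Flux_mul_four, d2q13Flux_mul_five,
    d2q13Flux_mul_six, d2q13Flux_mul_seven, d2q13Flux_mul_eight, d2q13Flux_mul_nine,
    Matrix.mul_fin_three_apply, R.secondMoments.apply, R.sigma5, s7, s9, R.a0, R.a1, ha2,
    R.conserved, R.z3, R.z4, R.z5, R.zflux, R.z10, R.z11, R.z12, h3, h4, h5, h6, h7, h8, h9] <;>
  field_simp <;>
  ring

/-- The symbol of `α₄`. -/
theorem a_three (R : D2Q13IsotropicRelations lam x y α φ κ c A K ν τ B₁ B₂ B₃ σ G a z)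
    {p q r p' q' r' ξ χ u₁ u₂ v₁ v₂ w₁ w₂ d₁ d₂ d₃ g₁ g₂ : ℝ}
    (ha2 : a 2 = !![0, ξ * lam ^ 2 * ((x ^ 2 + y ^ 2) * x), ξ * lam ^ 2 * ((x ^ 2 + y ^ 2) * y);
      χ * lam ^ 4 * ((x ^ 2 + y ^ 2) * x), 0, 0; χ * lam ^ 4 * ((x ^ 2 + y ^ 2) * y), 0, 0])
    (h6 : ∀ i, z 1 6 i = (![0, lam ^ 4 * (p * x ^ 2 + q * y ^ 2), lam ^ 4 * (r * (x * y))] :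
      Fin 3 → ℝ) i)
    (h7 : ∀ i, z 1 7 i = (![0, lam ^ 4 * (r * (x * y)), lam ^ 4 * (p * y ^ 2 + q * x ^ 2)] :
      Fin 3 → ℝ) i)
    (h8 : ∀ i, z 1 8 i = (![0, lam ^ 6 * (p' * x ^ 2 + q' * y ^ 2), lam ^ 6 * (r' * (x * y))] :
      Fin 3 → ℝ) i)
    (h9 : ∀ i, z 1 9 i = (![0, lam ^ 6 * (r' * (x * y)), lam ^ 6 * (p' * y ^ 2 + q' * x ^ 2)] :
      Fin 3 → ℝ) i)
    (k3 : ∀ i, z 2 3 i = (![0, lam ^ 4 * (u₁ * x ^ 3 + u₂ * (x * y ^ 2)),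
      lam ^ 4 * (u₁ * y ^ 3 + u₂ * (x ^ 2 * y))] : Fin 3 → ℝ) i)
    (k4 : ∀ i, z 2 4 i = (![0, lam ^ 4 * (v₁ * x ^ 3 + v₂ * (x * y ^ 2)),
      -(lam ^ 4 * (v₁ * y ^ 3 + v₂ * (x ^ 2 * y)))] : Fin 3 → ℝ) i)
    (k5 : ∀ i, z 2 5 i = (![0, lam ^ 4 * (w₁ * (x ^ 2 * y) + w₂ * y ^ 3),
      lam ^ 4 * (w₁ * (x * y ^ 2) + w₂ * x ^ 3)] : Fin 3 → ℝ) i)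
    (hd₁ : d₁ = -(1 / 156) * c * A * σ 3 - 1 / 6 * c * K * σ 4 + 1 / 156 * A * ν + 1 / 156 * A * τ +
      1 / 6 * K * ν + 1 / 6 * K * τ + 1 / 10 * p + 1 / 70 * p' + 1 / 26 * σ 3 * u₁ +
      1 / 2 * σ 4 * v₁)
    (hd₂ : d₂ = -(1 / 156) * c * A * σ 3 - 1 / 6 * c * K * σ 4 + 1 / 156 * A * ν + 1 / 156 * A * τ +
      1 / 3 * K * ν + 1 / 6 * K * τ - 1 / 60 * p + 1 / 10 * q - 1 / 30 * r - 1 / 70 * p' +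
      1 / 70 * q' - 1 / 35 * r' + 1 / 26 * σ 3 * u₂ + 1 / 2 * σ 4 * v₂ + σ 4 * w₁)
    (hd₃ : d₃ = 1 / 6 * K * ν - 1 / 60 * q - 1 / 70 * q' + σ 4 * w₂)
    (hg₁ : g₁ = -(1 / 156) * c * A * σ 3 - 1 / 6 * c * K * σ 4 + 1 / 156 * A * ν + 1 / 156 * A * τ +
      1 / 6 * K * τ - 1 / 30 * q + 1 / 10 * r - 1 / 35 * q' + 1 / 70 * r' + 1 / 26 * σ 3 * u₂ -
      1 / 2 * σ 4 * v₂ + σ 4 * w₂)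
    (hg₂ : g₂ = -(1 / 156) * c * A * σ 3 - 1 / 6 * c * K * σ 4 + 1 / 156 * A * ν + 1 / 156 * A * τ +
      1 / 6 * K * τ - 1 / 30 * p - 1 / 60 * r - 1 / 35 * p' - 1 / 70 * r' + 1 / 26 * σ 3 * u₁ -
      1 / 2 * σ 4 * v₁ + σ 4 * w₁) :
    a 3 = !![c / 12 * (A / 26 * σ 3 + K * σ 4) * lam ^ 4 * (x ^ 2 + y ^ 2) ^ 2, 0, 0;
      0, lam ^ 4 * (d₁ * x ^ 4 + d₂ * (x ^ 2 * y ^ 2) + d₃ * y ^ 4),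
        lam ^ 4 * (g₁ * (x ^ 3 * y) + g₂ * (x * y ^ 3));
      0, lam ^ 4 * (g₁ * (x * y ^ 3) + g₂ * (x ^ 3 * y)),
        lam ^ 4 * (d₁ * y ^ 4 + d₂ * (x ^ 2 * y ^ 2) + d₃ * x ^ 4)] := by
  subst hd₁ hd₂ hd₃ hg₁ hg₂
  obtain ⟨h3, h4, h5⟩ := R.z_one_second
  have hl := R.lam_ne_zero
  have e0 : ∀ i, (d2q13Equilibrium G * a 3) 0 i = a 3 0 i := fun i => by
    simp [Matrix.mul_fin_three_apply, d2q13Equilibrium_conserved]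
  have e1 : ∀ i, (d2q13Equilibrium G * a 3) 1 i = a 3 1 i := fun i => by
    simp [Matrix.mul_fin_three_apply, d2q13Equilibrium_conserved]
  have e2 : ∀ i, (d2q13Equilibrium G * a 3) 2 i = a 3 2 i := fun i => by
    simp [Matrix.mul_fin_three_apply, d2q13Equilibrium_conserved]
  apply mat3_ext <;>
  first
  | rw [R.a_three_apply (R.conserved 3 _).1 (e0 _)]
  | rw [R.a_three_apply (R.conserved 3 _).2.1 (e1 _)]
  | rw [R.a_three_apply (R.conserved 3 _).2.2 (e2 _)]
  all_goals
    simp [R.conserved, d2q13Flux_mul_zero, d2q13Flux_mul_one, d2q13Flux_mul_two,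
      d2q13Flux_mul_three, d2q13Flux_mul_four, d2q13Flux_mul_five, Matrix.mul_fin_three_apply,
      R.z3, R.z4, R.z5, h3, h4, h5, h6, h7, h8, h9, k3, k4, k5, R.a0, R.a1, ha2, R.sigma5]
  all_goals try (field_simp; ring)

end D2Q13IsotropicRelations

/-! ## Rotation invariance of acoustic systems -/

theorem rotationD_X_zero (θ : ℝ) :
    rotationD θ (X 0) = C (Real.cos θ) * X 0 - C (Real.sin θ) * X 1 := by
  simp [rotationD]

theorem rotationD_X_one (θ : ℝ) :
    rotationD θ (X 1) = C (Real.sin θ) * X 0 + C (Real.cos θ) * X 1 := by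
  simp [rotationD]

theorem C_cos_sq_add_C_sin_sq (θ : ℝ) :
    (C (Real.cos θ) ^ 2 + C (Real.sin θ) ^ 2 : DiffOp 2) = 1 := by
  rw [← C_pow, ← C_pow, ← C_add, Real.cos_sq_add_sin_sq, C_1]

theorem rotationD_lap (θ : ℝ) : rotationD θ lap = lap := by
  simp only [lap, map_add, map_pow, rotationD_X_zero, rotationD_X_one]
  linear_combination (X 0 ^ 2 + X 1 ^ 2) * C_cos_sq_add_C_sin_sq θ

/-- A system built from `p`, `q div`, `r ∇`, `m` and `n ∇ div` with rotation invariant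
scalar operators `p`, `q`, `r`, `m`, `n` is rotation invariant. -/
theorem isRotationInvariant_of_scalars {p q r m n : DiffOp 2} (hp : ∀ θ, rotationD θ p = p)
    (hq : ∀ θ, rotationD θ q = q) (hr : ∀ θ, rotationD θ r = r) (hm : ∀ θ, rotationD θ m = m)
    (hn : ∀ θ, rotationD θ n = n) :
    IsRotationInvariant !![p, q * X 0, q * X 1;
      r * X 0, m + n * X 0 ^ 2, n * (X 0 * X 1);
      r * X 1, n * (X 0 * X 1), m + n * X 1 ^ 2] := by
  intro θ
  ext1 i j
  fin_cases i <;> fin_cases j <;>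
  simp [rotationW, Matrix.mul_apply, Fin.sum_univ_three, hp θ, hq θ, hr θ, hm θ, hn θ,
    rotationD_X_zero, rotationD_X_one]
  -- The relation cos² + sin² = 1 is only needed on the diagonal of the momentum block, where m is
  -- conjugated by the rotation.
  all_goals first | ring1 | linear_combination -m * C_cos_sq_add_C_sin_sq θ

/-- All scalar operators involved are polynomials in `lap`. The lower orders are the cases of
vanishing coefficients. -/
theorem isRotationInvariant_acousticOrder4 (c0sq μ ζ ξ χ η μ4 ζ4 : ℝ) :
    IsRotationInvariant (acousticOrder4 c0sq μ ζ ξ χ η μ4 ζ4) := by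
  convert isRotationInvariant_of_scalars (p := C η * lap ^ 2) (q := 1 + C ξ * lap)
    (r := C c0sq + C χ * lap) (m := -(C μ * lap) + C μ4 * lap ^ 2) (n := -C ζ + C ζ4 * lap)
    ?_ ?_ ?_ ?_ ?_ using 1
  · ext1 i j
    fin_cases i <;> fin_cases j <;>
    simp [acousticOrder4, acousticOrder3, acousticOrder2, acousticOrder1] <;> ring
  all_goals simp [rotationD_lap]

theorem acousticOrder4_zero (c0sq μ ζ ξ χ : ℝ) :
    acousticOrder4 c0sq μ ζ ξ χ 0 0 0 = acousticOrder3 c0sq μ ζ ξ χ := by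
  ext1 i j
  fin_cases i <;> fin_cases j <;> simp [acousticOrder4]

theorem acousticOrder3_zero (c0sq μ ζ : ℝ) :
    acousticOrder3 c0sq μ ζ 0 0 = acousticOrder2 c0sq μ ζ := by
  ext1 i j
  fin_cases i <;> fin_cases j <;> simp [acousticOrder3]

theorem acousticOrder2_zero (c0sq : ℝ) : acousticOrder2 c0sq 0 0 = acousticOrder1 c0sq := by
  ext1 i j
  fin_cases i <;> fin_cases j <;> simp [acousticOrder2]

theorem isRotationInvariant_acousticOrder3 (c0sq μ ζ ξ χ : ℝ) :
    IsRotationInvariant (acousticOrder3 c0sq μ ζ ξ χ) := by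
  rw [← acousticOrder4_zero]
  apply isRotationInvariant_acousticOrder4

theorem isRotationInvariant_acousticOrder2 (c0sq μ ζ : ℝ) :
    IsRotationInvariant (acousticOrder2 c0sq μ ζ) := by
  rw [← acousticOrder3_zero]
  apply isRotationInvariant_acousticOrder3

theorem isRotationInvariant_acousticOrder1 (c0sq : ℝ) :
    IsRotationInvariant (acousticOrder1 c0sq) := by
  rw [← acousticOrder2_zero]
  apply isRotationInvariant_acousticOrder2

/-! ## Comparison of operators through their symbols -/

/-- A real polynomial is determined by its values, which justifies working at one point (x, y) at a
time. -/
theorem matrix_ext_eval {m n : Type*} {P Q : Matrix m n (DiffOp 2)}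
    (h : ∀ x y : ℝ, P.map (eval ![x, y]) = Q.map (eval ![x, y])) : P = Q := by
  ext1 i j
  refine MvPolynomial.funext fun v => ?_
  rw [show v = ![v 0, v 1] from List.ofFn_inj.mp rfl]
  exact congrFun (congrFun (h (v 0) (v 1)) i) j

theorem equivalentOperator_map_eval (𝒜 : PowerSeries (Matrix (Fin 3) (Fin 3) (DiffOp 2)))
    (dt : ℝ) (l : ℕ) (v : Fin 2 → ℝ) : (equivalentOperator 𝒜 dt l).map (eval v) =
      -∑ j ∈ Finset.range l, dt ^ j • (PowerSeries.coeff j 𝒜).map (eval v) := by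
  ext1 i j
  simp [equivalentOperator, Matrix.sum_apply, smul_eval]

theorem eval_lap (x y : ℝ) : eval ![x, y] lap = x ^ 2 + y ^ 2 := by
  simp [lap]

theorem acousticOrder1_map_eval (c0sq x y : ℝ) :
    (acousticOrder1 c0sq).map (eval ![x, y]) =
      !![0, x, y; c0sq * x, 0, 0; c0sq * y, 0, 0] := by
  apply mat3_ext <;> simp [acousticOrder1]

theorem acousticOrder2_map_eval (c0sq μ ζ x y : ℝ) :
    (acousticOrder2 c0sq μ ζ).map (eval ![x, y]) =
      !![0, x, y; c0sq * x, -(μ * (x ^ 2 + y ^ 2) + ζ * x ^ 2), -(ζ * (x * y));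
        c0sq * y, -(ζ * (x * y)), -(μ * (x ^ 2 + y ^ 2) + ζ * y ^ 2)] := by
  apply mat3_ext <;> simp [acousticOrder2, acousticOrder1, eval_lap]

theorem acousticOrder3_map_eval (c0sq μ ζ ξ χ x y : ℝ) :
    (acousticOrder3 c0sq μ ζ ξ χ).map (eval ![x, y]) =
      !![0, x + ξ * ((x ^ 2 + y ^ 2) * x), y + ξ * ((x ^ 2 + y ^ 2) * y);
        c0sq * x + χ * (x * (x ^ 2 + y ^ 2)),
          -(μ * (x ^ 2 + y ^ 2) + ζ * x ^ 2), -(ζ * (x * y));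
        c0sq * y + χ * (y * (x ^ 2 + y ^ 2)),
          -(ζ * (x * y)), -(μ * (x ^ 2 + y ^ 2) + ζ * y ^ 2)] := by
  apply mat3_ext <;> simp [acousticOrder3, acousticOrder2, acousticOrder1, eval_lap]

theorem acousticOrder4_map_eval (c0sq μ ζ ξ χ η μ4 ζ4 x y : ℝ) :
    (acousticOrder4 c0sq μ ζ ξ χ η μ4 ζ4).map (eval ![x, y]) =
      !![η * (x ^ 2 + y ^ 2) ^ 2, x + ξ * ((x ^ 2 + y ^ 2) * x), y + ξ * ((x ^ 2 + y ^ 2) * y);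
        c0sq * x + χ * (x * (x ^ 2 + y ^ 2)),
          -(μ * (x ^ 2 + y ^ 2) + ζ * x ^ 2) +
            (μ4 * (x ^ 2 + y ^ 2) ^ 2 + ζ4 * (x ^ 2 * (x ^ 2 + y ^ 2))),
          -(ζ * (x * y)) + ζ4 * (x * y * (x ^ 2 + y ^ 2));
        c0sq * y + χ * (y * (x ^ 2 + y ^ 2)),
          -(ζ * (x * y)) + ζ4 * (x * y * (x ^ 2 + y ^ 2)),
          -(μ * (x ^ 2 + y ^ 2) + ζ * y ^ 2) +
            (μ4 * (x ^ 2 + y ^ 2) ^ 2 + ζ4 * (y ^ 2 * (x ^ 2 + y ^ 2)))] := by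
  apply mat3_ext <;> simp [acousticOrder4, acousticOrder3, acousticOrder2, acousticOrder1, eval_lap]

/-! ### Isotropy at orders three and four -/

set_option maxHeartbeats 4000000 in
/-- The isotropy identities between the coefficients of the fourth order momentum equation. -/
theorem fourthOrder_coefficients {α a σ3 σ4 σ6 σ8 σ10 σ11 c A K ν τ ξ κ B₁ B₂ B₃
    p q r p' q' r' u₁ u₂ v₁ v₂ w₁ w₂ : ℝ} (h3 : σ3 ≠ 0) (h4 : σ4 ≠ 0) (ha : a - 308 ≠ 0)
    (ha' : 89 * a - 20680 ≠ 0) (hc' : 1189 * csq α - 828 ≠ 0)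
    (h6 : σ6 = 1 / (12 * σ3)) (h8 : σ8 = sigma8 a σ3 σ4) (h10 : σ10 = sigma10 α a σ3 σ4)
    (h11 : σ11 = sigma11 a σ4) (hc : c = csq α) (hA : A = 11 + 13 * -(7 / 5) - α)
    (hK : K = (3 + -(7 / 5)) / 4) (hν : ν = σ4 * K) (hτ : τ = σ3 * A / 26)
    (hξ : ξ = (A / 26 + K) / 12) (hκ : κ = rCoeff3 (-(7 / 5)))
    (h₁ : B₁ = -(143 / 4) + 5 * α - 77 / 26 * α * -(7 / 5) - 4689 / 52 * -(7 / 5))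
    (h₂ : B₂ = 6 - 1 / 48 * α + 135 / 208 * α * -(7 / 5) + 168 / 13 * -(7 / 5))
    (h₃ : B₃ = 13 / 12 + 9 / 4 * -(7 / 5))
    (hp : p = -(7 / 5) * ν + -(7 / 5) * τ - 5 / 77 * A * σ3 - 14 / 17 * K * σ4 -
      1 / 77 * B₁ * σ10 - 6 / 17 * B₃ * σ11)
    (hq : q = -(7 / 5) * ν + K * σ4)
    (hr : r = -(7 / 5) * τ - 5 / 77 * A * σ3 + 31 / 17 * K * σ4 - 1 / 77 * B₁ * σ10 +
      6 / 17 * B₃ * σ11)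
    (hp' : p' = -(12 / 17) * K * σ4 - 3 / 137 * B₁ * σ10 - 35 / 137 * B₂ * σ11 +
      7 / 17 * B₃ * σ11 + ν * κ + τ * κ)
    (hq' : q' = 3 * K * σ4 + ν * κ)
    (hr' : r' = 63 / 17 * K * σ4 - 3 / 137 * B₁ * σ10 - 35 / 137 * B₂ * σ11 -
      7 / 17 * B₃ * σ11 + τ * κ)
    (hu₁ : u₁ = α * ξ - 1 / 12 * c * A + c * A * σ3 ^ 2 - 2537 / 24024 * A - A * ν * σ3 -
      A * τ * σ3 - 123 / 68 * K - 13 / 924 * B₁ - 13 / 34 * B₃ - 13 * p * σ6)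
    (hu₂ : u₂ = α * ξ - 1 / 12 * c * A + c * A * σ3 ^ 2 - 2537 / 24024 * A - A * ν * σ3 -
      A * τ * σ3 + 437 / 204 * K - 13 / 924 * B₁ + 13 / 34 * B₃ - 13 * q * σ6 - 13 * r * σ6)
    (hv₁ : v₁ = -(1 / 6) * c * K + 2 * c * K * σ4 ^ 2 - 123 / 8008 * A - 65 / 204 * K -
      2 * K * ν * σ4 - 2 * K * τ * σ4 - 271 / 126588 * B₁ - 1 / 137 * B₂ - 1 / 34 * B₃ -
      7 / 5 * p * σ6 - 12 / 35 * p' * σ8)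
    (hv₂ : v₂ = 1 / 6 * c * K - 2 * c * K * σ4 ^ 2 + 123 / 8008 * A - 65 / 204 * K -
      2 * K * ν * σ4 + 2 * K * τ * σ4 + 271 / 126588 * B₁ + 1 / 137 * B₂ - 1 / 34 * B₃ -
      7 / 5 * q * σ6 + 7 / 5 * r * σ6 - 12 / 35 * q' * σ8 + 12 / 35 * r' * σ8)
    (hw₁ : w₁ = -(1 / 6) * c * K + 2 * c * K * σ4 ^ 2 + 1 / 3003 * A - 1 / 12 * K - K * ν * σ4 -
      2 * K * τ * σ4 + 67 / 63294 * B₁ + 1 / 137 * B₂ + 1 / 5 * p * σ6 + 1 / 5 * r * σ6 +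
      6 / 35 * p' * σ8 + 6 / 35 * r' * σ8)
    (hw₂ : w₂ = -(1 / 12) * K - K * ν * σ4 + 1 / 5 * q * σ6 + 6 / 35 * q' * σ8) :
    -(1 / 156) * c * A * σ3 - 1 / 6 * c * K * σ4 + 1 / 156 * A * ν + 1 / 156 * A * τ +
      1 / 6 * K * ν + 1 / 6 * K * τ + 1 / 10 * p + 1 / 70 * p' + 1 / 26 * σ3 * u₁ +
      1 / 2 * σ4 * v₁ = -(mu4 1 1 a σ3 σ4 + zeta4 1 1 α a σ3 σ4) ∧
    -(1 / 156) * c * A * σ3 - 1 / 6 * c * K * σ4 + 1 / 156 * A * ν + 1 / 156 * A * τ +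
      1 / 3 * K * ν + 1 / 6 * K * τ - 1 / 60 * p + 1 / 10 * q - 1 / 30 * r - 1 / 70 * p' +
      1 / 70 * q' - 1 / 35 * r' + 1 / 26 * σ3 * u₂ + 1 / 2 * σ4 * v₂ + σ4 * w₁ =
      -(2 * mu4 1 1 a σ3 σ4 + zeta4 1 1 α a σ3 σ4) ∧
    1 / 6 * K * ν - 1 / 60 * q - 1 / 70 * q' + σ4 * w₂ = -mu4 1 1 a σ3 σ4 ∧
    -(1 / 156) * c * A * σ3 - 1 / 6 * c * K * σ4 + 1 / 156 * A * ν + 1 / 156 * A * τ +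
      1 / 6 * K * τ - 1 / 30 * q + 1 / 10 * r - 1 / 35 * q' + 1 / 70 * r' + 1 / 26 * σ3 * u₂ -
      1 / 2 * σ4 * v₂ + σ4 * w₂ = -zeta4 1 1 α a σ3 σ4 ∧
    -(1 / 156) * c * A * σ3 - 1 / 6 * c * K * σ4 + 1 / 156 * A * ν + 1 / 156 * A * τ +
      1 / 6 * K * τ - 1 / 30 * p - 1 / 60 * r - 1 / 35 * p' - 1 / 70 * r' + 1 / 26 * σ3 * u₁ -
      1 / 2 * σ4 * v₁ + σ4 * w₁ = -zeta4 1 1 α a σ3 σ4 := by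
  have ha'' : a * 89 - 20680 ≠ 0 := by rwa [mul_comm]
  -- The first order coefficient B₁ of ε₂ equals (1189 c_s² - 828)/5, the factor in the denominator
  -- of σ₁₀ up to 1/5. Since σ₁₀ only occurs in the product B₁ σ₁₀, that denominator disappears
  -- here.
  have hT : B₁ * σ10 = 1 / 5 * (3973 / 45 * ((43 * a - 16610) / (89 * a - 20680)) *
      (5 * c - 4) * σ3 + 154 / 1395 * ((7 * a - 1391) / (89 * a - 20680)) *
      (725 * c - 418) * a * σ4) := by
    have e : B₁ = (1189 * csq α - 828) / 5 := by rw [h₁, csq]; ring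
    rw [h10, sigma10, e, hc]
    field_simp
  have hr₂ : r = -(7 / 5) * τ - 5 / 77 * A * σ3 + 31 / 17 * K * σ4 - 1 / 77 * (B₁ * σ10) +
      6 / 17 * B₃ * σ11 := by rw [hr]; ring
  have hp₂ : p = -(7 / 5) * ν + -(7 / 5) * τ - 5 / 77 * A * σ3 - 14 / 17 * K * σ4 -
      1 / 77 * (B₁ * σ10) - 6 / 17 * B₃ * σ11 := by rw [hp]; ring
  have hp₂' : p' = -(12 / 17) * K * σ4 - 3 / 137 * (B₁ * σ10) - 35 / 137 * B₂ * σ11 +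
      7 / 17 * B₃ * σ11 + ν * κ + τ * κ := by rw [hp']; ring
  have hr₂' : r' = 63 / 17 * K * σ4 - 3 / 137 * (B₁ * σ10) - 35 / 137 * B₂ * σ11 -
      7 / 17 * B₃ * σ11 + τ * κ := by rw [hr']; ring
  rw [hT] at hr₂ hp₂ hp₂' hr₂'
  clear hT hr hp hp' hr' h10 hc'
  rw [csq] at hc
  rw [rCoeff3] at hκ
  rw [sigma8] at h8
  rw [sigma11] at h11
  simp only [mu4, zeta4]
  -- The matching of d₁x⁴ + d₂x²y² + d₃y⁴ with μ₄(x² + y²)² + ζ₄x²(x² + y²), and of g₁x³y + g₂xy³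
  -- with ζ₄xy(x² + y²), up to the sign in `equivalentOperator`.
  refine ⟨?_, ?_, ?_, ?_, ?_⟩
  · rw [hu₁, hv₁, hp₂, hp₂', h8, h6, h11, hξ, hτ, hν, h₁, h₂, h₃, hκ, hK, hA, hc]
    field_simp
    ring
  · rw [hu₂, hv₂, hw₁, hp₂, hp₂', hr₂, hr₂', hq, hq', h8, h6, h11, hξ, hτ, hν, h₁, h₂,
      h₃, hκ, hK, hA, hc]
    field_simp
    ring
  · rw [hw₂, hq, hq', h8, h6, hν, hκ, hK]
    field_simp
    ring
  · rw [hu₂, hv₂, hw₂, hr₂, hr₂', hq, hq', h8, h6, h11, hξ, hτ, hν, h₁, h₂, h₃, hκ, hK, hA, hc]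
    field_simp
    ring
  · rw [hu₁, hv₁, hw₁, hp₂, hp₂', hr₂, hr₂', h8, h6, h11, hξ, hτ, hν, h₁, h₂, h₃, hκ, hK, hA, hc]
    field_simp
    ring

/-- Homogeneity: λ Δx³ = Δt³ λ⁴ when Δx = λ Δt, so the isotropy identities are only needed at λ = Δx
= 1. -/
theorem mu4_eq (lam dt a σ3 σ4 : ℝ) :
    mu4 lam (lam * dt) a σ3 σ4 = dt ^ 3 * lam ^ 4 * mu4 1 1 a σ3 σ4 := by
  unfold mu4
  ring

theorem zeta4_eq (lam dt α a σ3 σ4 : ℝ) :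
    zeta4 lam (lam * dt) α a σ3 σ4 = dt ^ 3 * lam ^ 4 * zeta4 1 1 α a σ3 σ4 := by
  unfold zeta4
  ring

/-- With B = 2K and σ₄ = σ₅ the XX and XY contributions to α₂ combine into the Laplacian term ν =
σ₄K, and ∇ div only keeps the part of ε. -/
theorem D2Q13Relations.isotropic {lam x y α φ : ℝ} {σ : Fin 13 → ℝ} {G : Matrix (Fin 13) (Fin 3) ℝ}
    {a : ℕ → Matrix (Fin 3) (Fin 3) ℝ} {z : ℕ → Matrix (Fin 13) (Fin 3) ℝ}
    (R : D2Q13Relations lam x y σ G a z) (h45 : σ 4 = σ 5)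
    (h2 : SecondMomentsEquilibrium lam α G) (hf : FluxEquilibrium lam φ (rCoeff3 φ) G)
    (hs : ScalarEquilibrium lam (eps2Coeff α φ) (eps3Coeff α φ) G) :
    D2Q13IsotropicRelations lam x y α φ (rCoeff3 φ) (csq α) (11 + 13 * φ - α) ((3 + φ) / 4)
      (σ 4 * ((3 + φ) / 4)) (σ 3 * (11 + 13 * φ - α) / 26)
      (-(143 / 4) + 5 * α - 77 / 26 * α * φ - 4689 / 52 * φ)
      (6 - 1 / 48 * α + 135 / 208 * α * φ + 168 / 13 * φ) (13 / 12 + 9 / 4 * φ) σ G a z := by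
  obtain ⟨h3, h4, h5⟩ := R.z_zero_third h2 hf
  obtain ⟨h10, h11, h12⟩ := R.z_zero_scalar h2 hf hs rfl rfl rfl
  refine ⟨R, h45.symm, h2, hf, R.a_zero h2, ?_, h3, h4, h5, R.z_zero_flux h2 hf hs, h10, h11, h12⟩
  rw [R.a_one h3 h4 h5, h45]
  -- The excluded simp lemma would turn equalities with a common factor `lam ^ 2` into disjunctions,
  -- out of reach of `ring`.
  apply mat3_ext <;> simp [-mul_eq_mul_left_iff] <;> ring

/-! ### The equivalent equations of orders one to four -/

section EquivalentEquations

variable {lam dx dt α φ : ℝ} {s σ : Fin 13 → ℝ} {G : Matrix (Fin 13) (Fin 3) ℝ}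
  {𝒜 : PowerSeries (Matrix (Fin 3) (Fin 3) (DiffOp 2))}
  {β : ℕ → Matrix (Fin 10) (Fin 3) (DiffOp 2)}

theorem equivalentOperator_one_eq (hlam : lam ≠ 0) (hs : ∀ k, 3 ≤ k → s k ≠ 0)
    (hσ : ∀ k, 3 ≤ k → σ k = 1 / s k - 1 / 2) (h : (d2q13 lam s G).IsFormalExpansion 𝒜 β)
    (h2 : SecondMomentsEquilibrium lam α G) :
    equivalentOperator 𝒜 dt 1 = acousticOrder1 (csq α * lam ^ 2) := by
  refine matrix_ext_eval fun x y => ?_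
  obtain ⟨z, R⟩ := exists_d2q13Relations hlam hs hσ h x y
  have e0 : (PowerSeries.coeff 0 𝒜).map (eval ![x, y]) = _ := R.a_zero h2
  rw [equivalentOperator_map_eval, acousticOrder1_map_eval, Finset.sum_range_one, e0]
  apply mat3_ext <;> simp

theorem equivalentOperator_two_eq (hlam : lam ≠ 0) (hdx : dx = lam * dt)
    (hs : ∀ k, 3 ≤ k → s k ≠ 0) (hσ : ∀ k, 3 ≤ k → σ k = 1 / s k - 1 / 2)
    (h : (d2q13 lam s G).IsFormalExpansion 𝒜 β) (h2 : SecondMomentsEquilibrium lam α G)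
    (h45 : σ 4 + σ 5 ≠ 0) (hf : FluxEquilibrium lam φ (rCoeff2 φ (σ 4) (σ 5)) G) :
    equivalentOperator 𝒜 dt 2 = acousticOrder2 (csq α * lam ^ 2)
      (lam * dx / 2 * (σ 4 * σ 5 / (σ 4 + σ 5)) * (3 + φ))
      (lam * dx / 26 * σ 3 * (11 + 13 * φ - α)) := by
  refine matrix_ext_eval fun x y => ?_
  obtain ⟨z, R⟩ := exists_d2q13Relations hlam hs hσ h x y
  obtain ⟨h3, h4, h5⟩ := R.z_zero_second h2 hf
  -- Isotropy of α₂ amounts to σ₄B = 2σ₅K. Together with B + 2K = 3 + φ this determines B and K, and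
  -- `rCoeff2` is the coefficient of r^eq that produces them.
  have eB : 17 / 7 + 7 / 5 * φ + 12 / 35 * rCoeff2 φ (σ 4) (σ 5) =
      (3 + φ) * σ 5 / (σ 4 + σ 5) := by
    unfold rCoeff2
    field_simp
    ring
  have eK : 2 / 7 - 1 / 5 * φ - 6 / 35 * rCoeff2 φ (σ 4) (σ 5) =
      (3 + φ) / 2 * (σ 4 / (σ 4 + σ 5)) := by
    unfold rCoeff2
    field_simp
    ring
  have e0 : (PowerSeries.coeff 0 𝒜).map (eval ![x, y]) = _ := R.a_zero h2
  have e1 : (PowerSeries.coeff 1 𝒜).map (eval ![x, y]) = _ := R.a_one h3 h4 h5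
  rw [eB, eK] at e1
  rw [equivalentOperator_map_eval, acousticOrder2_map_eval, Finset.sum_range_succ,
    Finset.sum_range_one, e0, e1, hdx]
  apply mat3_ext <;> simp <;> ring

/-- Row 0 of the flux only reads the rows of J, which vanish in every z n. In the mass row of the
third relation only the 1/12 correction survives, so ξ contains no relaxation parameter. -/
theorem equivalentOperator_three_mass (hlam : lam ≠ 0) (hdx : dx = lam * dt)
    (hs : ∀ k, 3 ≤ k → s k ≠ 0) (hσ : ∀ k, 3 ≤ k → σ k = 1 / s k - 1 / 2)
    (h : (d2q13 lam s G).IsFormalExpansion 𝒜 β) (h2 : SecondMomentsEquilibrium lam α G)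
    (hf : FluxEquilibrium lam φ (rCoeff3 φ) G) :
    equivalentOperator 𝒜 dt 3 0 =
      ![0, X 0 + C (1 / 624 * (2 * α - 39 * φ - 61) * dx ^ 2) * (lap * X 0),
        X 1 + C (1 / 624 * (2 * α - 39 * φ - 61) * dx ^ 2) * (lap * X 1)] := by
  have key : ∀ x y : ℝ, ∀ j, eval ![x, y] (equivalentOperator 𝒜 dt 3 0 j) = eval ![x, y]
      ((![0, X 0 + C (1 / 624 * (2 * α - 39 * φ - 61) * dx ^ 2) * (lap * X 0),
        X 1 + C (1 / 624 * (2 * α - 39 * φ - 61) * dx ^ 2) * (lap * X 1)] :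
          Fin 3 → DiffOp 2) j) := by
    intro x y j
    obtain ⟨z, R⟩ := exists_d2q13Relations hlam hs hσ h x y
    obtain ⟨h3, h4, h5⟩ := R.z_zero_third h2 hf
    have e0 : (PowerSeries.coeff 0 𝒜).map (eval ![x, y]) = _ := R.a_zero h2
    have e1 : (PowerSeries.coeff 1 𝒜).map (eval ![x, y]) = _ := R.a_one h3 h4 h5
    obtain ⟨m0, m1, m2⟩ := R.a_two_mass h3 h4 h5
    rw [Matrix.map_apply] at m0 m1 m2
    have e := congrFun (congrFun (equivalentOperator_map_eval 𝒜 dt 3 ![x, y]) 0) j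
    rw [Matrix.map_apply] at e
    rw [e, Finset.sum_range_succ, Finset.sum_range_succ, Finset.sum_range_one, e0, e1]
    fin_cases j <;> simp [m0, m1, m2, eval_lap, hdx] <;> ring
  funext j
  refine MvPolynomial.funext fun v => ?_
  rw [show v = ![v 0, v 1] from List.ofFn_inj.mp rfl]
  exact key (v 0) (v 1) j

theorem equivalentOperator_three_eq (hlam : lam ≠ 0) (hdx : dx = lam * dt)
    (hs : ∀ k, 3 ≤ k → s k ≠ 0) (hσ : ∀ k, 3 ≤ k → σ k = 1 / s k - 1 / 2)
    (h : (d2q13 lam s G).IsFormalExpansion 𝒜 β) (h2 : SecondMomentsEquilibrium lam α G)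
    (h45 : σ 4 = σ 5) (hf : FluxEquilibrium lam φ (rCoeff3 φ) G)
    (he : ScalarEquilibrium lam (eps2Coeff α φ) (eps3Coeff α φ) G) :
    equivalentOperator 𝒜 dt 3 = acousticOrder3 (csq α * lam ^ 2)
      (1 / 4 * σ 5 * (3 + φ) * lam * dx) (1 / 26 * σ 3 * (11 + 13 * φ - α) * lam * dx)
      (1 / 624 * (2 * α - 39 * φ - 61) * dx ^ 2) (chi3 lam dx α φ (σ 3) (σ 4)) := by
  refine matrix_ext_eval fun x y => ?_
  obtain ⟨z, R₀⟩ := exists_d2q13Relations hlam hs hσ h x y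
  have R := R₀.isotropic h45 h2 hf he
  have e0 : (PowerSeries.coeff 0 𝒜).map (eval ![x, y]) = _ := R.a0
  have e1 : (PowerSeries.coeff 1 𝒜).map (eval ![x, y]) = _ := R.a1
  have e2 : (PowerSeries.coeff 2 𝒜).map (eval ![x, y]) = _ := R.a_two rfl rfl
  rw [equivalentOperator_map_eval, acousticOrder3_map_eval, Finset.sum_range_succ,
    Finset.sum_range_succ, Finset.sum_range_one, e0, e1, e2, hdx, ← h45]
  apply mat3_ext <;> simp [chi3, csq] <;> ring

theorem equivalentOperator_four_eq {a : ℝ} (hlam : lam ≠ 0) (hdx : dx = lam * dt)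
    (hs : ∀ k, 3 ≤ k → s k ≠ 0) (hσ : ∀ k, 3 ≤ k → σ k = 1 / s k - 1 / 2)
    (h : (d2q13 lam s G).IsFormalExpansion 𝒜 β) (h2 : SecondMomentsEquilibrium lam α G)
    (h45 : σ 4 = σ 5) (σ3_ne : σ 3 ≠ 0) (σ4_ne : σ 4 ≠ 0) (ha : a ≠ 308)
    (ha' : 89 * a ≠ 20680) (hc : 1189 * csq α ≠ 828)
    (h6 : σ 6 = 1 / (12 * σ 3)) (h7 : σ 7 = 1 / (12 * σ 3))
    (h8 : σ 8 = sigma8 a (σ 3) (σ 4)) (h9 : σ 9 = sigma8 a (σ 3) (σ 4))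
    (h10 : σ 10 = sigma10 α a (σ 3) (σ 4))
    (h11 : σ 11 = sigma11 a (σ 4)) (h12 : σ 12 = sigma11 a (σ 4))
    (hf : FluxEquilibrium lam (-(7 / 5)) (rCoeff3 (-(7 / 5))) G)
    (he : ScalarEquilibrium lam (eps2Coeff α (-(7 / 5))) (eps3Coeff α (-(7 / 5))) G) :
    equivalentOperator 𝒜 dt 4 = acousticOrder4 (csq α * lam ^ 2)
      (2 / 5 * σ 4 * lam * dx) (-(1 / 130) * σ 3 * (36 + 5 * α) * lam * dx)
      ((5 * α - 16) / 1560 * dx ^ 2) (chi4 lam dx α (σ 3) (σ 4)) (eta4 lam dx α (σ 3) (σ 4))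
      (mu4 lam dx a (σ 3) (σ 4)) (zeta4 lam dx α a (σ 3) (σ 4)) := by
  refine matrix_ext_eval fun x y => ?_
  obtain ⟨z, R₀⟩ := exists_d2q13Relations hlam hs hσ h x y
  have R := R₀.isotropic h45 h2 hf he
  -- The `rfl` arguments here and below assign to each coefficient letter its defining expression.
  obtain ⟨f6, f7, f8, f9⟩ := R.z_one_flux (h12.trans h11.symm) rfl rfl rfl rfl rfl rfl
  have ha2 := R.a_two rfl rfl
  obtain ⟨k3, k4, k5⟩ := R.z_two_second (h7.trans h6.symm) (h9.trans h8.symm) ha2 f6 f7 f8 f9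
    rfl rfl rfl rfl rfl rfl
  obtain ⟨d₁, d₂, d₃, g₁, g₂⟩ := fourthOrder_coefficients σ3_ne σ4_ne (sub_ne_zero.2 ha)
    (sub_ne_zero.2 ha') (sub_ne_zero.2 hc) h6 h8 h10 h11 rfl rfl rfl rfl rfl rfl rfl rfl rfl rfl
    rfl rfl rfl rfl rfl rfl rfl rfl rfl rfl rfl rfl
  have e0 : (PowerSeries.coeff 0 𝒜).map (eval ![x, y]) = _ := R.a0
  have e1 : (PowerSeries.coeff 1 𝒜).map (eval ![x, y]) = _ := R.a1
  have e2 : (PowerSeries.coeff 2 𝒜).map (eval ![x, y]) = _ := ha2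
  have e3 : (PowerSeries.coeff 3 𝒜).map (eval ![x, y]) = _ :=
    R.a_three ha2 f6 f7 f8 f9 k3 k4 k5 d₁.symm d₂.symm d₃.symm g₁.symm g₂.symm
  rw [equivalentOperator_map_eval, acousticOrder4_map_eval, Finset.sum_range_succ,
    Finset.sum_range_succ, Finset.sum_range_succ, Finset.sum_range_one, e0, e1, e2, e3, hdx,
    mu4_eq, zeta4_eq]
  apply mat3_ext <;> simp [chi4, csq, eta4] <;> ring

end EquivalentEquations

/-! ## Positivity of the relaxation parameters -/

theorem sigma8_pos {a σ3 σ4 : ℝ} (ha : 155 < a) (ha' : a < 1391 / 7) (h3 : 0 < σ3) (h4 : 0 < σ4) :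
    0 < sigma8 a σ3 σ4 := by
  have h1 : 0 < (155 - a) / (a - 308) := div_pos_of_neg_of_neg (by linarith) (by linarith)
  have h2 : 0 < (7 * a - 1391) / (a - 308) := div_pos_of_neg_of_neg (by linarith) (by linarith)
  unfold sigma8
  positivity

/-- Every quotient has a negative denominator and a numerator that is negative, except that 725 c_s²
- 418 may vanish at the endpoint of the range of α. The first summand is then still positive. -/
theorem sigma10_pos {α a σ3 σ4 : ℝ} (hα : -28 < α) (hα' : α ≤ -(9432 / 725)) (ha : 155 < a)
    (ha' : a < 1391 / 7) (h3 : 0 < σ3) (h4 : 0 < σ4) : 0 < sigma10 α a σ3 σ4 := by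
  have hc : 0 < csq α := by unfold csq; linarith
  have hc' : csq α ≤ 418 / 725 := by unfold csq; linarith
  have h1 : 0 < (43 * a - 16610) / (89 * a - 20680) :=
    div_pos_of_neg_of_neg (by linarith) (by linarith)
  have h2 : 0 < (5 * csq α - 4) / (1189 * csq α - 828) :=
    div_pos_of_neg_of_neg (by linarith) (by linarith)
  have h5 : 0 < (7 * a - 1391) / (89 * a - 20680) :=
    div_pos_of_neg_of_neg (by linarith) (by linarith)
  have h6 : 0 ≤ (725 * csq α - 418) / (1189 * csq α - 828) :=
    div_nonneg_of_nonpos (by linarith) (by linarith)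
  have h7 : 0 < a := by linarith
  unfold sigma10
  positivity

theorem sigma11_pos {a σ4 : ℝ} (ha : 155 < a) (h4 : 0 < σ4) : 0 < sigma11 a σ4 := by
  have : 0 < a := by linarith
  unfold sigma11
  positivity

/-! ### The main theorem -/

theorem mainTheorem2
    (dx dt lam : ℝ) (hdx : 0 < dx) (hdt : 0 < dt) (hlam : lam = dx / dt)
    (s σ : Fin 13 → ℝ) (hs : ∀ k, 3 ≤ k → s k ≠ 0) (hσ : ∀ k, 3 ≤ k → σ k = 1 / s k - 1 / 2)
    (G : Matrix (Fin 13) (Fin 3) ℝ) (α φ a : ℝ) :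
    -- the scheme is well defined and has exactly one formal expansion
    IsUnit (d2q13Matrix lam).det ∧
    (∃! p : PowerSeries (Matrix (Fin 3) (Fin 3) (DiffOp 2)) ×
        (ℕ → Matrix (Fin 10) (Fin 3) (DiffOp 2)),
      (d2q13 lam s G).IsFormalExpansion p.1 p.2) ∧
    (∀ (𝒜 : PowerSeries (Matrix (Fin 3) (Fin 3) (DiffOp 2)))
        (β : ℕ → Matrix (Fin 10) (Fin 3) (DiffOp 2)),
      (d2q13 lam s G).IsFormalExpansion 𝒜 β →
      SecondMomentsEquilibrium lam α G →
      -- first order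
      (IsRotationInvariant (equivalentOperator 𝒜 dt 1) ∧
        equivalentOperator 𝒜 dt 1 = acousticOrder1 (csq α * lam ^ 2)) ∧
      -- second order
      (σ 4 + σ 5 ≠ 0 → FluxEquilibrium lam φ (rCoeff2 φ (σ 4) (σ 5)) G →
        IsRotationInvariant (equivalentOperator 𝒜 dt 2) ∧
        equivalentOperator 𝒜 dt 2 = acousticOrder2 (csq α * lam ^ 2)
          (lam * dx / 2 * (σ 4 * σ 5 / (σ 4 + σ 5)) * (3 + φ))
          (lam * dx / 26 * σ 3 * (11 + 13 * φ - α))) ∧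
      -- third order, mass equation
      (σ 4 = σ 5 → FluxEquilibrium lam φ (rCoeff3 φ) G →
        equivalentOperator 𝒜 dt 3 0 =
          ![0, MvPolynomial.X 0 + MvPolynomial.C (1 / 624 * (2 * α - 39 * φ - 61) * dx ^ 2) *
                (lap * MvPolynomial.X 0),
            MvPolynomial.X 1 + MvPolynomial.C (1 / 624 * (2 * α - 39 * φ - 61) * dx ^ 2) *
                (lap * MvPolynomial.X 1)]) ∧
      -- third order, full system
      (σ 4 = σ 5 → FluxEquilibrium lam φ (rCoeff3 φ) G →
        ScalarEquilibrium lam (eps2Coeff α φ) (eps3Coeff α φ) G →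
        IsRotationInvariant (equivalentOperator 𝒜 dt 3) ∧
        equivalentOperator 𝒜 dt 3 = acousticOrder3 (csq α * lam ^ 2)
          (1 / 4 * σ 5 * (3 + φ) * lam * dx)
          (1 / 26 * σ 3 * (11 + 13 * φ - α) * lam * dx)
          (1 / 624 * (2 * α - 39 * φ - 61) * dx ^ 2)
          (chi3 lam dx α φ (σ 3) (σ 4))) ∧
      -- fourth order
      (σ 4 = σ 5 → σ 3 ≠ 0 → σ 4 ≠ 0 →
        a ≠ 308 → 89 * a ≠ 20680 → 1189 * csq α ≠ 828 →
        σ 6 = 1 / (12 * σ 3) → σ 7 = 1 / (12 * σ 3) →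
        σ 8 = sigma8 a (σ 3) (σ 4) → σ 9 = sigma8 a (σ 3) (σ 4) →
        σ 10 = sigma10 α a (σ 3) (σ 4) →
        σ 11 = sigma11 a (σ 4) → σ 12 = sigma11 a (σ 4) →
        FluxEquilibrium lam (-(7 / 5)) (rCoeff3 (-(7 / 5))) G →
        ScalarEquilibrium lam (eps2Coeff α (-(7 / 5))) (eps3Coeff α (-(7 / 5))) G →
        IsRotationInvariant (equivalentOperator 𝒜 dt 4) ∧
        equivalentOperator 𝒜 dt 4 = acousticOrder4 (csq α * lam ^ 2)
          (2 / 5 * σ 4 * lam * dx)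
          (-(1 / 130) * σ 3 * (36 + 5 * α) * lam * dx)
          ((5 * α - 16) / 1560 * dx ^ 2)
          (chi4 lam dx α (σ 3) (σ 4))
          (eta4 lam dx α (σ 3) (σ 4))
          (mu4 lam dx a (σ 3) (σ 4))
          (zeta4 lam dx α a (σ 3) (σ 4)))) ∧
    -- the equilibria of third order for `φ = -7/5`
    (rCoeff3 (-(7 / 5)) = 29 / 30 ∧
      eps2Coeff α (-(7 / 5)) = -(1189 / 130 * α + 7546 / 65) ∧
      eps3Coeff α (-(7 / 5)) = 547 / 39 + 145 / 156 * α) ∧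
    -- positivity of the relaxation parameters fixed at fourth order
    (-28 < α → α ≤ -(9432 / 725) → 155 < a → a < 1391 / 7 →
      ∀ σ3 σ4 : ℝ, 0 < σ3 → 0 < σ4 →
        0 < sigma8 a σ3 σ4 ∧ 0 < sigma10 α a σ3 σ4 ∧ 0 < sigma11 a σ4) := by

  have hl : lam ≠ 0 := hlam ▸ (div_pos hdx hdt).ne'
  have hx : dx = lam * dt := by rw [hlam, div_mul_cancel₀ _ hdt.ne']
  have hr : ∀ l, (d2q13 lam s G).relax l ≠ 0 := fun l => hs _ (by simp [Fin.le_def])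
  refine ⟨isUnit_det_d2q13Matrix hl,
    LinearScheme.existsUnique_isFormalExpansion _ (isUnit_det_d2q13Matrix hl) hr,
    fun 𝒜 β h h2 => ⟨?_, fun h45 hf => ?_,
      fun _ hf => equivalentOperator_three_mass hl hx hs hσ h h2 hf,
      fun h45 hf he => ?_,
      fun h45 n3 n4 ha ha' hc h6 h7 h8 h9 h10 h11 h12 hf he => ?_⟩, ⟨?_, ?_, ?_⟩,
    fun hα hα' ha ha' σ3 σ4 h3 h4 =>
      ⟨sigma8_pos ha ha' h3 h4, sigma10_pos hα hα' ha ha' h3 h4, sigma11_pos ha h4⟩⟩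
  · rw [equivalentOperator_one_eq hl hs hσ h h2]
    exact ⟨isRotationInvariant_acousticOrder1 _, rfl⟩
  · rw [equivalentOperator_two_eq hl hx hs hσ h h2 h45 hf]
    exact ⟨isRotationInvariant_acousticOrder2 _ _ _, rfl⟩
  · rw [equivalentOperator_three_eq hl hx hs hσ h h2 h45 hf he]
    exact ⟨isRotationInvariant_acousticOrder3 _ _ _ _ _, rfl⟩
  · rw [equivalentOperator_four_eq hl hx hs hσ h h2 h45 n3 n4 ha ha' hc h6 h7 h8 h9 h10 h11
      h12 hf he]
    exact ⟨isRotationInvariant_acousticOrder4 _ _ _ _ _ _ _ _, rfl⟩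
  · norm_num [rCoeff3]
  · rw [eps2Coeff]
    ring
  · rw [eps3Coeff]
    ring
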